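/- Let $x_0\in(0,\infty]$, let $I=[0,x_0)$, and let $f:I\to[0,\infty)$ be continuous. For a complex $n\times n$ matrix $X$ with real spectrum let $\lambda_1(X)\ge\dots\ge\lambda_n(X)$ be its eigenvalues, counted with algebraic multiplicity. Then the following are equivalent. (i) For all $n\ge1$ and all positive definite $n\times n$ complex (Hermitian) matrices $A,B$ with spectrum in $I$, the weak log-submajorisation $\lambda(f(A)f(B))\prec_{w(\log)} f^2\bigl(\sqrt{\lambda(AB)}\bigr)$ holds, that is, $$\prod_{j=1}^k\lambda_j\bigl(f(A)f(B)\bigr)\le\prod_{j=1}^k f\Bigl(\sqrt{\lambda_j(AB)}\Bigr)^2\qquad\text{for all }k=1,\dots,n,$$ where $f(A)$ and $f(B)$ are given by the functional calculus. (The numbers $f(\sqrt{\lambda_j(AB)})^2$ are taken in the order of the index $j$ and are not rearranged.) (ii) $f$ is in class $\mathcal A$: $f$ is geometrically concave, i.e. $\sqrt{f(x)f(y)}\le f(\sqrt{xy})$ for all $x,y\in I$, and $0\le x f'(x)\le f(x)$ for all $x\in I$ at which the derivative $f'(x)$ exists (one-sided at $x=0$). -/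

import Mathlib

open scoped ComplexOrder

namespace GeomALT

/-- The interval `[0, x₀)` of real numbers; `x₀ = ⊤` gives `[0, ∞)`. -/
def dom (x₀ : EReal) : Set ℝ := {x : ℝ | 0 ≤ x ∧ (x : EReal) < x₀}

/-- Geometric concavity on `[0, x₀)`. -/
def GeometricallyConcave (x₀ : EReal) (f : ℝ → ℝ) : Prop :=
  ∀ x ∈ dom x₀, ∀ y ∈ dom x₀, √(f x * f y) ≤ f (√(x * y))

/-- The class `𝒜` of functions with domain `[0, x₀)`; only the values of `f` on `[0, x₀)` matter.
The condition on the derivative is imposed at the points of `[0, x₀)` where it exists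
(a one-sided derivative at `0`, the ordinary derivative elsewhere). -/
structure ClassA (x₀ : EReal) (f : ℝ → ℝ) : Prop where
  continuousOn : ContinuousOn f (dom x₀)
  nonneg : ∀ x ∈ dom x₀, 0 ≤ f x
  geometricallyConcave : GeometricallyConcave x₀ f
  deriv_bounds : ∀ x ∈ dom x₀, ∀ f' : ℝ, HasDerivWithinAt f f' (dom x₀) x →
    0 ≤ x * f' ∧ x * f' ≤ f x

/-- The real parts of the eigenvalues of a complex square matrix, with algebraic multiplicity, in
non-increasing order. When the spectrum is real these are the eigenvalues themselves. -/
noncomputable def eigenvalueList {n : ℕ} (M : Matrix (Fin n) (Fin n) ℂ) : List ℝ :=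
  (M.charpoly.roots.map Complex.re).sort (· ≥ ·)

theorem length_eigenvalueList {n : ℕ} (M : Matrix (Fin n) (Fin n) ℂ) :
    (eigenvalueList M).length = n := by
  have h := IsAlgClosed.card_roots_eq_natDegree (p := M.charpoly)
  simp [eigenvalueList, h, Matrix.charpoly_natDegree_eq_dim]

/-- `eig M j` is the eigenvalue `λ_{j+1}(M)` of a matrix `M` with real spectrum, where
`λ₁(M) ≥ ⋯ ≥ λₙ(M)` are counted with algebraic multiplicity. -/
noncomputable def eig {n : ℕ} (M : Matrix (Fin n) (Fin n) ℂ) (j : Fin n) : ℝ :=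
  (eigenvalueList M).get (j.cast (length_eigenvalueList M).symm)

/-- The relation `x ≺_{w(log)} y`: every partial product of the first `k` entries of `x` is at most
that of `y`, for `k = 1, …, n`. The entries are taken in the order in which they are listed. -/
def LogSubmajorizedBy {n : ℕ} (x y : Fin n → ℝ) : Prop :=
  ∀ k : Fin n, ∏ j ∈ Finset.Iic k, x j ≤ ∏ j ∈ Finset.Iic k, y j

end GeomALT

/-! Sufficiency is a convexity argument in the exponent. If `f` vanishes at all positive points, the
left side is zero. Otherwise `f` is positive at all of them, and F(t) = log f(e^t) is concave with
slopes in [0, 1]. A given pair A, B involves only finitely many points, and on a finite set F equals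
c + ∑ w_s min(t, s) with w_s ≥ 0 and ∑ w_s ≤ 1 (`exists_eq_sum_min`). So f may be replaced by e^G,
where G is a convex combination of the constant c and of the functions min(log x, s) + c.

For these generators the inequality holds eigenvalue by eigenvalue, because the eigenvalues of PQ
increase with P and Q. It passes to convex combinations (`convex_goodExponents`): for fixed k the
logarithm of the left side is convex in G and that of the right side is linear. The convexity comes
from `sq_prod_eig_mul_le`, a Cauchy–Schwarz inequality for determinants combined with an extremal
bound for products of top eigenvalues.

Necessity uses sizes 1 and 2 only. Scalars give geometric concavity, A = B = diag(a, b) gives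
monotonicity, and diag(a, b) against a rotated copy, as b → 0, gives c f(a) ≤ f(ca) for 0 < c ≤ 1.
The last two facts bound the left difference quotients. -/

namespace GeomALT
open Matrix Polynomial

/-! ### Eigenvalues of a product of positive definite matrices -/

theorem eig_antitone {n : ℕ} (M : Matrix (Fin n) (Fin n) ℂ) : Antitone (eig M) := by
  have h := (Multiset.pairwise_sort (M.charpoly.roots.map Complex.re) (· ≥ ·)).sortedGE
  intro i j hij
  exact h.antitone_get (by exact hij)

/-- The eigenvalue list is determined by a factorization of the characteristic polynomial. -/
theorem eig_eq_of_charpoly {n : ℕ} {M : Matrix (Fin n) (Fin n) ℂ} {d : Fin n → ℝ}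
    (hd : Antitone d) (h : M.charpoly = ∏ i, (X - C (d i : ℂ))) : eig M = d := by
  have hr : M.charpoly.roots.map Complex.re = Multiset.map d Finset.univ.val := by
    rw [h, Polynomial.roots_prod _ _ (by simp [Finset.prod_ne_zero_iff, X_sub_C_ne_zero])]
    simp [Multiset.bind_singleton, Function.comp_def]
  have hs : eigenvalueList M = List.ofFn d := by
    rw [eigenvalueList, hr, Fin.univ_val_map, Multiset.coe_sort]
    apply List.mergeSort_of_pairwise
    simp_rw [decide_eq_true_eq, ← List.sortedGE_iff_pairwise]
    exact hd.sortedGE_ofFn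
  funext j
  simp [eig, hs]

/-- If `M S = S diag(d)` with `S` invertible and `d` non-increasing, then `eig M = d`. -/
theorem eig_eq_of_mul_eq {n : ℕ} {M S : Matrix (Fin n) (Fin n) ℂ} {d : Fin n → ℝ}
    (hd : Antitone d) (hS : IsUnit S) (h : M * S = S * diagonal (fun i => (d i : ℂ))) :
    eig M = d := by
  refine eig_eq_of_charpoly hd ?_
  obtain ⟨u, rfl⟩ := hS
  have : M = u.val * diagonal (fun i => (d i : ℂ)) * u⁻¹.val := by
    rw [← h, mul_assoc, Units.mul_inv, mul_one]
  rw [this, charpoly_mul_comm, ← mul_assoc, Units.inv_mul, one_mul, charpoly_diagonal]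

/-- A Hermitian matrix has an orthonormal eigenbasis with non-increasing eigenvalues. -/
theorem exists_unitary_diagonal {n : ℕ} {H : Matrix (Fin n) (Fin n) ℂ} (hH : H.IsHermitian) :
    ∃ (U : Matrix (Fin n) (Fin n) ℂ) (d : Fin n → ℝ), Antitone d ∧ Uᴴ * U = 1 ∧ U * Uᴴ = 1 ∧
      Uᴴ * H * U = diagonal (fun i => (d i : ℂ)) := by
  let σ : Equiv.Perm (Fin n) := Tuple.sort (fun i => - hH.eigenvalues i)
  have hσ := Tuple.monotone_sort (fun i => - hH.eigenvalues i)
  let V : Matrix (Fin n) (Fin n) ℂ := hH.eigenvectorUnitary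
  have hV : Vᴴ * V = 1 := Unitary.coe_star_mul_self hH.eigenvectorUnitary
  have hVH : Vᴴ * H * V = diagonal (fun i => (hH.eigenvalues i : ℂ)) := by
    have := hH.conjStarAlgAut_star_eigenvectorUnitary
    rw [Unitary.conjStarAlgAut_apply] at this
    simpa [V, star_eq_conjTranspose, Function.comp_def] using this
  have h1 : (V.submatrix id σ)ᴴ * V.submatrix id σ = 1 := by
    have : (V.submatrix id σ)ᴴ * V.submatrix id σ = (Vᴴ * V).submatrix σ σ := by
      ext i j
      simp [mul_apply, submatrix_apply]
    rw [this, hV, submatrix_one_equiv]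
  refine ⟨V.submatrix id σ, fun i => hH.eigenvalues (σ i), fun i j hij => ?_, h1,
    mul_eq_one_comm.1 h1, ?_⟩
  · have := hσ hij
    simpa using this
  · have : (V.submatrix id σ)ᴴ * H * V.submatrix id σ = (Vᴴ * H * V).submatrix σ σ := by
      ext i j
      simp [mul_apply, submatrix_apply]
    rw [this, hVH]
    ext i j
    simp [diagonal_apply]

theorem eig_mul_comm {n : ℕ} (P Q : Matrix (Fin n) (Fin n) ℂ) : eig (P * Q) = eig (Q * P) := by
  have h : eigenvalueList (P * Q) = eigenvalueList (Q * P) := by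
    simp only [eigenvalueList, charpoly_mul_comm P Q]
  funext j
  simp [eig, h]

/-- Simultaneous diagonalization of two positive definite matrices. -/
theorem exists_congr_diagonal {n : ℕ} {P Q : Matrix (Fin n) (Fin n) ℂ} (hP : P.IsHermitian)
    (hQ : Q.PosDef) :
    ∃ T : Matrix (Fin n) (Fin n) ℂ, IsUnit T ∧ T * Tᴴ = Q ∧
      Tᴴ * P * T = diagonal (fun i => (eig (P * Q) i : ℂ)) := by
  obtain ⟨R, hRu, hR⟩ : ∃ R : Matrix (Fin n) (Fin n) ℂ, IsUnit R ∧ R * Rᴴ = Q := by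
    open scoped MatrixOrder in
    have h0 : 0 ≤ Q := hQ.posSemidef.nonneg
    have h := CFC.sqrt_mul_sqrt_self Q h0
    refine ⟨CFC.sqrt Q, ?_, ?_⟩
    · exact isUnit_of_mul_isUnit_left (h ▸ hQ.isUnit)
    · have : (CFC.sqrt Q)ᴴ = CFC.sqrt Q := (CFC.sqrt_nonneg Q).posSemidef.isHermitian
      rw [this, h]
  have hH : (Rᴴ * P * R).IsHermitian := isHermitian_conjTranspose_mul_mul _ hP
  obtain ⟨U, d, hd, hU, hU', hUH⟩ := exists_unitary_diagonal hH
  have hUu : IsUnit U := IsUnit.of_mul_eq_one _ hU'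
  have hT : IsUnit (R * U) := hRu.mul hUu
  have hTT : R * U * (R * U)ᴴ = Q := by
    rw [conjTranspose_mul, mul_assoc, ← mul_assoc U, hU', one_mul, hR]
  have hTP : (R * U)ᴴ * P * (R * U) = diagonal (fun i => (d i : ℂ)) := by
    rw [← hUH, conjTranspose_mul]; simp only [mul_assoc]
  -- With T = RU one has T Tᴴ = Q and Tᴴ P T = D, so QPT = T(Tᴴ P T) = TD.
  have he : eig (Q * P) = d := by
    refine eig_eq_of_mul_eq hd hT ?_
    rw [← hTT, ← hTP]; simp only [mul_assoc]
  exact ⟨R * U, hT, hTT, by rw [hTP, eig_mul_comm P, he]⟩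

theorem eig_mul_pos {n : ℕ} {P Q : Matrix (Fin n) (Fin n) ℂ} (hP : P.PosDef) (hQ : Q.PosDef)
    (j : Fin n) : 0 < eig (P * Q) j := by
  obtain ⟨T, hT, -, hD⟩ := exists_congr_diagonal hP.isHermitian hQ
  have h : (Tᴴ * P * T).PosDef :=
    hP.conjTranspose_mul_mul_same (mulVec_injective_of_isUnit hT)
  rw [hD, posDef_diagonal_iff] at h
  exact_mod_cast h j

theorem eig_smul_one {n : ℕ} (c : ℝ) (j : Fin n) :
    eig ((c : ℂ) • (1 : Matrix (Fin n) (Fin n) ℂ)) j = c := by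
  have := eig_eq_of_mul_eq (M := (c : ℂ) • (1 : Matrix (Fin n) (Fin n) ℂ)) (S := 1)
    (d := fun _ => c) antitone_const isUnit_one (by simp [smul_one_eq_diagonal])
  rw [this]

theorem eig_smul {n : ℕ} {P Q : Matrix (Fin n) (Fin n) ℂ} (hP : P.IsHermitian) (hQ : Q.PosDef)
    {c : ℝ} (hc : 0 ≤ c) (j : Fin n) : eig ((c : ℂ) • (P * Q)) j = c * eig (P * Q) j := by
  obtain ⟨T, hT, hTT, hD⟩ := exists_congr_diagonal hP hQ
  have h : eig ((c : ℂ) • (Q * P)) = fun j => c * eig (P * Q) j := by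
    refine eig_eq_of_mul_eq (fun i j hij => mul_le_mul_of_nonneg_left (eig_antitone _ hij) hc)
      hT ?_
    have : diagonal (fun i => ((c * eig (P * Q) i : ℝ) : ℂ)) = (c : ℂ) • (Tᴴ * P * T) := by
      rw [hD]; ext i j; by_cases h : i = j <;> simp [h]
    rw [this, ← hTT]
    simp [mul_assoc]
  rw [← smul_mul_assoc, eig_mul_comm, mul_smul_comm, h]

/-- Monotonicity of the eigenvalues of `P Q` in `P`. -/
theorem eig_mul_mono_left {n : ℕ} {P P' Q : Matrix (Fin n) (Fin n) ℂ} (hP : P.IsHermitian)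
    (hP' : P'.IsHermitian) (hQ : Q.PosDef) (h : (P' - P).PosSemidef) (j : Fin n) :
    eig (P * Q) j ≤ eig (P' * Q) j := by
  obtain ⟨T, hT, hTT, hD⟩ := exists_congr_diagonal hP hQ
  obtain ⟨T', hT', hTT', hD'⟩ := exists_congr_diagonal hP' hQ
  set d := eig (P * Q)
  set d' := eig (P' * Q)
  -- The change of basis W is unitary because T and T' both factor the same Q.
  obtain ⟨W, hW⟩ : ∃ W, T = T' * W := ⟨T'⁻¹ * T, by
    rw [← mul_assoc, mul_nonsing_inv _ ((isUnit_iff_isUnit_det _).1 hT'), one_mul]⟩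
  have hWW : Wᴴ * W = 1 := by
    have h1 : T' * (W * Wᴴ) * T'ᴴ = T' * 1 * T'ᴴ := by
      rw [mul_one, hTT', ← hTT, hW, conjTranspose_mul]; simp only [mul_assoc]
    have h2 := hT'.mul_left_cancel ((IsUnit.star hT').mul_right_cancel h1)
    exact mul_eq_one_comm.1 h2
  -- a vector supported on `{0, …, j}` whose image under `W` is supported on `{j, …}`
  obtain ⟨y, hy0, hy1, hy2⟩ : ∃ y : Fin n → ℂ, y ≠ 0 ∧ (∀ i, j < i → y i = 0) ∧
      ∀ i, i < j → (W *ᵥ y) i = 0 := by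
    -- One linear condition for each index other than j: n − 1 conditions on n unknowns leave a
    -- nonzero solution.
    let L : (Fin n → ℂ) →ₗ[ℂ] ({i : Fin n // i ≠ j} → ℂ) :=
      LinearMap.pi fun i => if i.1 < j then (LinearMap.proj i.1).comp (mulVecLin W)
        else LinearMap.proj i.1
    have hL : LinearMap.ker L ≠ ⊥ := by
      apply LinearMap.ker_ne_bot_of_finrank_lt
      simp only [Module.finrank_fintype_fun_eq_card, Fintype.card_fin]
      have : Fintype.card {i : Fin n // i ≠ j} = n - 1 := by
        rw [Fintype.card_subtype_compl]; simp
      rw [this]; have := j.pos; omega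
    obtain ⟨y, hy, hy0⟩ := (Submodule.ne_bot_iff _).1 hL
    have hy' : ∀ i : {i : Fin n // i ≠ j}, L y i = 0 := fun i => congrFun hy i
    refine ⟨y, hy0, fun i hi => ?_, fun i hi => ?_⟩
    · simpa [L, hi.not_gt] using hy' ⟨i, hi.ne'⟩
    · simpa [L, hi] using hy' ⟨i, hi.ne⟩
  have key : ∀ (e : Fin n → ℝ) (v : Fin n → ℂ),
      star v ⬝ᵥ (diagonal (fun i => (e i : ℂ)) *ᵥ v) = ((∑ i, e i * Complex.normSq (v i) : ℝ) : ℂ) := by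
    intro e v
    simp only [dotProduct, mulVec_diagonal, Pi.star_apply, Complex.ofReal_sum, Complex.ofReal_mul,
      Complex.normSq_eq_conj_mul_self]
    exact Finset.sum_congr rfl fun i _ => by simp; ring
  have hq : ∀ M : Matrix (Fin n) (Fin n) ℂ, star (T *ᵥ y) ⬝ᵥ (M *ᵥ (T *ᵥ y)) =
      star y ⬝ᵥ ((Tᴴ * M * T) *ᵥ y) := fun M => by
    simp only [star_mulVec, dotProduct_mulVec, vecMul_vecMul, mul_assoc]
  have hq' : ∀ M : Matrix (Fin n) (Fin n) ℂ, star (T *ᵥ y) ⬝ᵥ (M *ᵥ (T *ᵥ y)) =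
      star (W *ᵥ y) ⬝ᵥ ((T'ᴴ * M * T') *ᵥ (W *ᵥ y)) := fun M => by
    rw [hW]
    simp only [star_mulVec, dotProduct_mulVec, vecMul_vecMul, mul_assoc, conjTranspose_mul]
  -- Courant–Fischer comparison at Ty: the form of P is at least d_j‖y‖², that of P' at most
  -- d'_j‖Wy‖², and W preserves the norm.
  have h0 := h.dotProduct_mulVec_nonneg (T *ᵥ y)
  rw [sub_mulVec, dotProduct_sub, hq P, hq' P', hD, hD', key, key] at h0
  have h1 : ∑ i, d i * Complex.normSq (y i) ≤ ∑ i, d' i * Complex.normSq ((W *ᵥ y) i) := by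
    have h0' : (0 : ℂ) ≤ ((∑ i, d' i * Complex.normSq ((W *ᵥ y) i) -
      ∑ i, d i * Complex.normSq (y i) : ℝ) : ℂ) := by simpa using h0
    linarith [Complex.zero_le_real.1 h0']
  have hn : ∑ i, Complex.normSq ((W *ᵥ y) i) = ∑ i, Complex.normSq (y i) := by
    have h2 : star (W *ᵥ y) ⬝ᵥ (W *ᵥ y) = star y ⬝ᵥ y := by
      rw [star_mulVec, dotProduct_mulVec, vecMul_vecMul, hWW, vecMul_one]
    have h3 := key (fun _ => 1) (W *ᵥ y)
    have h4 := key (fun _ => 1) y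
    simp only [Complex.ofReal_one, diagonal_one, one_mulVec, one_mul] at h3 h4
    rw [h3, h4] at h2
    exact_mod_cast h2
  have hpos : 0 < ∑ i, Complex.normSq (y i) := by
    obtain ⟨i, hi⟩ := Function.ne_iff.1 hy0
    exact Finset.sum_pos' (fun i _ => Complex.normSq_nonneg _)
      ⟨i, Finset.mem_univ _, Complex.normSq_pos.2 hi⟩
  have h5 : d j * ∑ i, Complex.normSq (y i) ≤ ∑ i, d i * Complex.normSq (y i) := by
    rw [Finset.mul_sum]
    refine Finset.sum_le_sum fun i _ => ?_
    rcases le_or_gt i j with hij | hij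
    · exact mul_le_mul_of_nonneg_right (eig_antitone _ hij) (Complex.normSq_nonneg _)
    · simp [hy1 i hij]
  have h6 : ∑ i, d' i * Complex.normSq ((W *ᵥ y) i) ≤ d' j * ∑ i, Complex.normSq (y i) := by
    rw [← hn, Finset.mul_sum]
    refine Finset.sum_le_sum fun i _ => ?_
    rcases le_or_gt j i with hij | hij
    · exact mul_le_mul_of_nonneg_right (eig_antitone _ hij) (Complex.normSq_nonneg _)
    · simp [hy2 i hij]
  exact le_of_mul_le_mul_right (by linarith) hpos

theorem eig_mul_mono {n : ℕ} {P P' Q Q' : Matrix (Fin n) (Fin n) ℂ} (hP : P.PosDef)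
    (hP' : P'.PosDef) (hQ : Q.PosDef) (hQ' : Q'.PosDef) (h : (P' - P).PosSemidef)
    (h' : (Q' - Q).PosSemidef) (j : Fin n) : eig (P * Q) j ≤ eig (P' * Q') j := by
  refine (eig_mul_mono_left hP.isHermitian hP'.isHermitian hQ h j).trans ?_
  rw [eig_mul_comm P', eig_mul_comm P']
  exact eig_mul_mono_left hQ.isHermitian hQ'.isHermitian hP' h' j

/-! ### Determinant inequalities -/

section Determinants

variable {m ι : Type*} [Fintype m] [DecidableEq m] [Fintype ι] [DecidableEq ι]

theorem one_le_det_one_add {K : Matrix m m ℂ} (hK : K.PosSemidef) : 1 ≤ (1 + K).det := by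
  have h : (1 + K).det = ∏ i, ((1 + hK.1.eigenvalues i : ℝ) : ℂ) := by
    let V : Matrix m m ℂ := hK.1.eigenvectorUnitary
    have hV : Vᴴ * V = 1 := Unitary.coe_star_mul_self hK.1.eigenvectorUnitary
    have hVK : Vᴴ * K * V = diagonal (fun i => (hK.1.eigenvalues i : ℂ)) := by
      have := hK.1.conjStarAlgAut_star_eigenvectorUnitary
      rw [Unitary.conjStarAlgAut_apply] at this
      simpa [V, star_eq_conjTranspose, Function.comp_def] using this
    have h1 : Vᴴ * (1 + K) * V = diagonal (fun i => ((1 + hK.1.eigenvalues i : ℝ) : ℂ)) := by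
      rw [Matrix.mul_add, Matrix.add_mul, Matrix.mul_one, hV, hVK, ← diagonal_one, diagonal_add]
      simp
    rw [← det_diagonal, ← h1, det_mul, det_mul, mul_right_comm, ← det_mul, hV, det_one, _root_.one_mul]
  rw [h, ← Complex.ofReal_prod, ← Complex.ofReal_one, Complex.real_le_real]
  exact Finset.one_le_prod (fun i => by simpa using hK.eigenvalues_nonneg i)

theorem exists_mul_conjTranspose_eq {M : Matrix m m ℂ} (hM : M.PosSemidef) :
    ∃ R : Matrix m m ℂ, R * Rᴴ = M := by
  open scoped MatrixOrder in
  have h0 : 0 ≤ M := hM.nonneg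
  refine ⟨CFC.sqrt M, ?_⟩
  have : (CFC.sqrt M)ᴴ = CFC.sqrt M := (CFC.sqrt_nonneg M).posSemidef.isHermitian
  rw [this, CFC.sqrt_mul_sqrt_self M h0]

/-- The determinant is monotone on positive semidefinite matrices. -/
theorem det_le_det {M N : Matrix m m ℂ} (hM : M.PosSemidef) (h : (N - M).PosSemidef) :
    M.det ≤ N.det := by
  have hN : N.PosSemidef := by simpa using h.add hM
  by_cases h0 : M.det = 0
  · rw [h0]; exact hN.det_nonneg
  · obtain ⟨R, hR⟩ := exists_mul_conjTranspose_eq hM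
    have hRd : IsUnit R.det := by
      refine isUnit_iff_ne_zero.2 fun h => h0 ?_
      rw [← hR, det_mul, h, zero_mul]
    have hRd' : IsUnit Rᴴ.det := by rw [det_conjTranspose]; exact hRd.star
    have hK : (R⁻¹ * (N - M) * (R⁻¹)ᴴ).PosSemidef := h.mul_mul_conjTranspose_same _
    -- For invertible M = RRᴴ this reduces the claim to det(1 + K) ≥ 1 with K positive semidefinite.
    have hNe : N = R * (1 + R⁻¹ * (N - M) * (R⁻¹)ᴴ) * Rᴴ := by
      rw [Matrix.mul_add, Matrix.add_mul, Matrix.mul_one, hR, conjTranspose_nonsing_inv, ← Matrix.mul_assoc R, ← Matrix.mul_assoc R,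
        mul_nonsing_inv _ hRd, Matrix.one_mul, Matrix.mul_assoc, nonsing_inv_mul _ hRd', Matrix.mul_one]
      abel
    have hd : N.det = M.det * (1 + R⁻¹ * (N - M) * (R⁻¹)ᴴ).det := by
      conv_lhs => rw [hNe]
      rw [← hR, det_mul, det_mul, det_mul]; ring
    rw [hd]
    exact le_mul_of_one_le_right hM.det_nonneg (one_le_det_one_add hK)

/-- The subtracted matrix is the orthogonal projection onto the range of X, so the difference is a
Hermitian idempotent and hence equals its own Gram matrix. -/
theorem posSemidef_one_sub_projection {X : Matrix m ι ℂ} (hX : Function.Injective X.mulVec) :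
    (1 - X * (Xᴴ * X)⁻¹ * Xᴴ).PosSemidef := by
  have hG : (Xᴴ * X).PosDef := PosDef.conjTranspose_mul_self X hX
  have hGu : IsUnit (Xᴴ * X).det := (isUnit_iff_isUnit_det _).1 hG.isUnit
  set G := Xᴴ * X with hGdef
  have hherm : (1 - X * G⁻¹ * Xᴴ)ᴴ = 1 - X * G⁻¹ * Xᴴ := by
    rw [conjTranspose_sub, conjTranspose_one, conjTranspose_mul, conjTranspose_mul,
      conjTranspose_conjTranspose, conjTranspose_nonsing_inv, hG.1.eq, Matrix.mul_assoc]
  have hidem : X * G⁻¹ * Xᴴ * (X * G⁻¹ * Xᴴ) = X * G⁻¹ * Xᴴ := by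
    calc _ = X * (G⁻¹ * G) * G⁻¹ * Xᴴ := by rw [hGdef]; simp only [Matrix.mul_assoc]
      _ = _ := by rw [nonsing_inv_mul _ hGu, Matrix.mul_one]
  have := posSemidef_conjTranspose_mul_self (1 - X * G⁻¹ * Xᴴ)
  rwa [hherm, Matrix.sub_mul, Matrix.one_mul, Matrix.mul_sub, Matrix.mul_one, hidem, sub_self, sub_zero] at this

/-- The Cauchy–Schwarz inequality for determinants. -/
theorem det_conjTranspose_mul_le {X Y : Matrix m ι ℂ} (hX : Function.Injective X.mulVec) :
    star (Xᴴ * Y).det * (Xᴴ * Y).det ≤ (Xᴴ * X).det * (Yᴴ * Y).det := by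
  have hG : (Xᴴ * X).PosDef := PosDef.conjTranspose_mul_self X hX
  have hGu : IsUnit (Xᴴ * X).det := (isUnit_iff_isUnit_det _).1 hG.isUnit
  -- Projecting Y onto the range of X can only decrease its Gram matrix, hence its Gram determinant.
  have h1 : (Yᴴ * (X * (Xᴴ * X)⁻¹ * Xᴴ) * Y).det ≤ (Yᴴ * Y).det := by
    refine det_le_det ?_ ?_
    · have := hG.inv.posSemidef.conjTranspose_mul_mul_same (Xᴴ * Y)
      simpa [conjTranspose_mul, Matrix.mul_assoc] using this
    · have := (posSemidef_one_sub_projection hX).conjTranspose_mul_mul_same Y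
      simpa [Matrix.mul_sub, Matrix.sub_mul] using this
  have h2 : star (Xᴴ * Y).det * (Xᴴ * Y).det =
      (Xᴴ * X).det * (Yᴴ * (X * (Xᴴ * X)⁻¹ * Xᴴ) * Y).det := by
    have : Yᴴ * (X * (Xᴴ * X)⁻¹ * Xᴴ) * Y = (Xᴴ * Y)ᴴ * (Xᴴ * X)⁻¹ * (Xᴴ * Y) := by
      simp [conjTranspose_mul, Matrix.mul_assoc]
    rw [this, det_mul, det_mul, det_conjTranspose, det_nonsing_inv]
    have h3 : (Xᴴ * X).det * Ring.inverse (Xᴴ * X).det = 1 := Ring.mul_inverse_cancel _ hGu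
    linear_combination (-(star (Xᴴ * Y).det * (Xᴴ * Y).det)) * h3
  rw [h2]
  exact mul_le_mul_of_nonneg_left h1 hG.posSemidef.det_nonneg

/-- Write R = 1 + EEᴴ. Sylvester's identity turns det R into det(1 + EᴴE) and the left side into
det(WᴴW) det(1 + EᴴΠE), where Π ≤ 1 is the projection onto the range of W. -/
theorem det_compression_le_of_one_le {R : Matrix m m ℂ} {W : Matrix m ι ℂ}
    (hR : (R - 1).PosSemidef) (hW : Function.Injective W.mulVec) :
    (Wᴴ * R * W).det ≤ R.det * (Wᴴ * W).det := by
  obtain ⟨E, hE⟩ := exists_mul_conjTranspose_eq hR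
  have hG : (Wᴴ * W).PosDef := PosDef.conjTranspose_mul_self W hW
  have hGu : IsUnit (Wᴴ * W).det := (isUnit_iff_isUnit_det _).1 hG.isUnit
  have hRE : R = 1 + E * Eᴴ := by rw [hE]; abel
  have h1 : Wᴴ * R * W = (Wᴴ * W) * (1 + ((Wᴴ * W)⁻¹ * (Wᴴ * E)) * (Eᴴ * W)) := by
    rw [Matrix.mul_add, ← Matrix.mul_assoc, ← Matrix.mul_assoc, ← Matrix.mul_assoc,
      mul_nonsing_inv _ hGu, hRE]
    simp [Matrix.mul_add, Matrix.add_mul, Matrix.mul_assoc]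
  rw [h1, det_mul, det_one_add_mul_comm, mul_comm, hRE, det_one_add_mul_comm E]
  refine mul_le_mul_of_nonneg_right (det_le_det ?_ ?_) hG.posSemidef.det_nonneg
  · refine PosSemidef.one.add ?_
    have := hG.inv.posSemidef.conjTranspose_mul_mul_same (Wᴴ * E)
    simpa [conjTranspose_mul, Matrix.mul_assoc] using this
  · have := (posSemidef_one_sub_projection hW).conjTranspose_mul_mul_same E
    simpa [Matrix.mul_sub, Matrix.sub_mul, Matrix.mul_assoc] using this

end Determinants

/-! ### Products of the largest eigenvalues -/

theorem prod_Iic_eq {n : ℕ} {M : Type*} [CommMonoid M] (k : Fin n) (d : Fin n → M) :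
    ∏ i : {i : Fin n // i ≤ k}, d i = ∏ i ∈ Finset.Iic k, d i :=
  (Finset.prod_subtype (Finset.Iic k) (fun _ => Finset.mem_Iic) d).symm

/-- The diagonal matrix is dominated by d_k R with R = diag(max(d_i/d_k, 1)) ≥ 1. Only indices i ≤ k
contribute to det R, so the powers of d_k cancel exactly and leave the product of the leading d_i.
-/
theorem det_compression_diagonal_le {n : ℕ} (k : Fin n) {d : Fin n → ℝ} (hd : Antitone d)
    (hd0 : ∀ i, 0 < d i) {W : Matrix (Fin n) {i : Fin n // i ≤ k} ℂ}
    (hW : Function.Injective W.mulVec) :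
    (Wᴴ * diagonal (fun i => (d i : ℂ)) * W).det ≤
      ((∏ i ∈ Finset.Iic k, d i : ℝ) : ℂ) * (Wᴴ * W).det := by
  set r : Fin n → ℝ := fun i => max (d i / d k) 1
  have hδ := hd0 k
  set R : Matrix (Fin n) (Fin n) ℂ := diagonal (fun i => (r i : ℂ))
  have hR : (R - 1).PosSemidef := by
    rw [← diagonal_one, diagonal_sub, posSemidef_diagonal_iff]
    intro i
    have : (1 : ℝ) ≤ r i := le_max_right _ _
    simpa using (by exact_mod_cast this : (1 : ℂ) ≤ (r i : ℂ))
  have hD : (diagonal (fun i => (d i : ℂ))).PosSemidef := by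
    rw [posSemidef_diagonal_iff]
    intro i
    simpa using (hd0 i).le
  have hDR : (((d k : ℝ) : ℂ) • R - diagonal (fun i => (d i : ℂ))).PosSemidef := by
    rw [← diagonal_smul, diagonal_sub, posSemidef_diagonal_iff]
    intro i
    have h1 : d i ≤ d k * r i := by
      calc d i = d k * (d i / d k) := by field_simp
        _ ≤ _ := mul_le_mul_of_nonneg_left (le_max_left _ _) hδ.le
    have h2 : (d i : ℂ) ≤ (d k : ℂ) * (r i : ℂ) := by exact_mod_cast h1
    simpa using h2
  have hprod : d k ^ (Fintype.card {i : Fin n // i ≤ k}) * ∏ i, r i = ∏ i ∈ Finset.Iic k, d i := by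
    have h1 : ∏ i, r i = ∏ i ∈ Finset.Iic k, r i := by
      refine (Finset.prod_subset (Finset.subset_univ _) fun i _ hi => ?_).symm
      have hi' : k < i := by simpa using hi
      exact max_eq_right ((div_le_one hδ).2 (hd hi'.le))
    have h2 : ∀ i ∈ Finset.Iic k, d k * r i = d i := fun i hi => by
      have : r i = d i / d k := max_eq_left ((one_le_div hδ).2 (hd (Finset.mem_Iic.1 hi)))
      rw [this]; field_simp
    rw [h1, Fintype.card_subtype, ← Finset.prod_congr rfl h2, Finset.prod_mul_distrib,
      Finset.prod_const]
    congr 3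
    ext i; simp
  calc _ ≤ (Wᴴ * (((d k : ℝ) : ℂ) • R) * W).det := by
        refine det_le_det (hD.conjTranspose_mul_mul_same W) ?_
        simpa [Matrix.mul_sub, Matrix.sub_mul] using hDR.conjTranspose_mul_mul_same W
    _ = (d k : ℂ) ^ (Fintype.card {i : Fin n // i ≤ k}) * (Wᴴ * R * W).det := by
        rw [Matrix.mul_smul, Matrix.smul_mul, det_smul]
    _ ≤ (d k : ℂ) ^ (Fintype.card {i : Fin n // i ≤ k}) * (R.det * (Wᴴ * W).det) := by
        refine mul_le_mul_of_nonneg_left (det_compression_le_of_one_le hR hW) ?_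
        exact_mod_cast pow_nonneg hδ.le _
    _ = _ := by
        rw [← hprod, det_diagonal]; push_cast; ring

/-- Extremal bound for the product of the largest eigenvalues of `P Q`. -/
theorem det_compression_le {n : ℕ} (k : Fin n) {P Q : Matrix (Fin n) (Fin n) ℂ} (hP : P.PosDef)
    (hQ : Q.PosDef) {U : Matrix (Fin n) {i : Fin n // i ≤ k} ℂ}
    (hU : Function.Injective U.mulVec) :
    (Uᴴ * P * U).det ≤ ((∏ i ∈ Finset.Iic k, eig (P * Q) i : ℝ) : ℂ) * (Uᴴ * Q⁻¹ * U).det := by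
  obtain ⟨T, hT, hTT, hD⟩ := exists_congr_diagonal hP.isHermitian hQ
  have hTd := (isUnit_iff_isUnit_det _).1 hT
  have hTd' : IsUnit Tᴴ.det := by rw [det_conjTranspose]; exact hTd.star
  obtain ⟨W, rfl⟩ : ∃ W, U = T * W := ⟨T⁻¹ * U, by
    rw [← Matrix.mul_assoc, mul_nonsing_inv _ hTd, Matrix.one_mul]⟩
  have hW : Function.Injective W.mulVec := by
    intro x y hxy
    apply hU
    change W *ᵥ x = W *ᵥ y at hxy
    rw [← mulVec_mulVec, hxy, mulVec_mulVec]
  have h1 : (T * W)ᴴ * P * (T * W) = Wᴴ * diagonal (fun i => (eig (P * Q) i : ℂ)) * W := by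
    rw [← hD, conjTranspose_mul]; simp only [Matrix.mul_assoc]
  have h2 : (T * W)ᴴ * Q⁻¹ * (T * W) = Wᴴ * W := by
    rw [← hTT, Matrix.mul_inv_rev, conjTranspose_mul]
    calc _ = Wᴴ * ((Tᴴ * Tᴴ⁻¹) * (T⁻¹ * T)) * W := by simp only [Matrix.mul_assoc]
      _ = _ := by rw [mul_nonsing_inv _ hTd', nonsing_inv_mul _ hTd, Matrix.mul_one, Matrix.mul_one]
  rw [h1, h2]
  exact det_compression_diagonal_le k (eig_antitone _) (eig_mul_pos hP hQ) hW

/-- Log-convexity at midpoints of the product of the largest eigenvalues. -/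
theorem sq_prod_eig_mul_le {n : ℕ} (k : Fin n) {P₁ P₂ Q₁ Q₂ : Matrix (Fin n) (Fin n) ℂ}
    (hP₁ : P₁.PosDef) (hP₂ : P₂.PosDef) (hQ₁ : Q₁.PosDef) (hQ₂ : Q₂.PosDef)
    (hP : (P₁ * P₂).PosDef) (hQ : (Q₂ * Q₁).PosDef) :
    (∏ i ∈ Finset.Iic k, eig (P₁ * P₂ * (Q₂ * Q₁)) i) ^ 2 ≤
      (∏ i ∈ Finset.Iic k, eig (P₁ * P₁ * (Q₁ * Q₁)) i) *
        ∏ i ∈ Finset.Iic k, eig (P₂ * P₂ * (Q₂ * Q₂)) i := by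
  obtain ⟨T, hT, hTT, hD⟩ := exists_congr_diagonal hP.isHermitian hQ
  have hTd := (isUnit_iff_isUnit_det _).1 hT
  have hTd' : IsUnit Tᴴ.det := by rw [det_conjTranspose]; exact hTd.star
  set d := eig (P₁ * P₂ * (Q₂ * Q₁))
  set D := diagonal (fun i => (d i : ℂ))
  have hP₁d := (isUnit_iff_isUnit_det _).1 hP₁.isUnit
  let E : Matrix (Fin n) {i : Fin n // i ≤ k} ℂ := (1 : Matrix (Fin n) (Fin n) ℂ).submatrix id (↑)
  have hE : Eᴴ * E = 1 := by
    ext i j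
    simp [E, mul_apply, one_apply, Subtype.ext_iff]
  have hDE : D * E = E * diagonal (fun i : {i : Fin n // i ≤ k} => (d i : ℂ)) := by
    ext i j
    rw [diagonal_mul, mul_diagonal]
    by_cases h : i = j <;> simp [E, one_apply, h]
  -- The columns of (Tᴴ)⁻¹ are eigenvectors of P₁P₂Q₂Q₁. Conjugation by P₁ makes those of U₀
  -- eigenvectors of P₂Q₂Q₁P₁ = (Q₂P₂)ᴴ(Q₁P₁), a form suited to Cauchy–Schwarz; E selects the
  -- leading ones.
  set U₀ := P₁⁻¹ * (Tᴴ)⁻¹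
  have hU₀ : P₂ * Q₂ * Q₁ * P₁ * U₀ = U₀ * D := by
    have h1 : P₁ * P₂ * (Q₂ * Q₁) * (Tᴴ)⁻¹ = (Tᴴ)⁻¹ * D := by
      rw [← hTT, ← hD]
      calc _ = P₁ * P₂ * T * (Tᴴ * Tᴴ⁻¹) := by simp only [Matrix.mul_assoc]
        _ = Tᴴ⁻¹ * Tᴴ * (P₁ * P₂ * T) := by
          rw [mul_nonsing_inv _ hTd', nonsing_inv_mul _ hTd', Matrix.one_mul, Matrix.mul_one]
        _ = _ := by simp only [Matrix.mul_assoc]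
    calc _ = P₂ * Q₂ * Q₁ * (P₁ * P₁⁻¹) * Tᴴ⁻¹ := by simp only [U₀, Matrix.mul_assoc]
      _ = P₁⁻¹ * P₁ * (P₂ * Q₂ * Q₁ * Tᴴ⁻¹) := by
        rw [mul_nonsing_inv _ hP₁d, nonsing_inv_mul _ hP₁d, Matrix.one_mul, Matrix.mul_one]
      _ = P₁⁻¹ * (P₁ * P₂ * (Q₂ * Q₁) * Tᴴ⁻¹) := by simp only [Matrix.mul_assoc]
      _ = _ := by rw [h1]; simp only [U₀, Matrix.mul_assoc]
  have hU₀u : IsUnit U₀ := by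
    rw [isUnit_iff_isUnit_det, det_mul]
    exact (isUnit_nonsing_inv_det _ hP₁d).mul (isUnit_nonsing_inv_det _ hTd')
  have hinj : ∀ V : Matrix (Fin n) (Fin n) ℂ, IsUnit V → Function.Injective (V * E).mulVec := by
    intro V hV x y hxy
    change (V * E) *ᵥ x = (V * E) *ᵥ y at hxy
    rw [← mulVec_mulVec, ← mulVec_mulVec] at hxy
    have h1 := mulVec_injective_of_isUnit hV hxy
    have h2 := congrArg (fun z => Eᴴ *ᵥ z) h1
    simpa [mulVec_mulVec, hE] using h2
  -- The extremal bound for Q² and P², compressed by P U₀ E: the inverse of P² then cancels and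
  -- leaves the Gram determinant of U₀E.
  have hbound : ∀ {P Q : Matrix (Fin n) (Fin n) ℂ}, P.PosDef → Q.PosDef →
      ((Q * P * (U₀ * E))ᴴ * (Q * P * (U₀ * E))).det ≤
        ((∏ i ∈ Finset.Iic k, eig (P * P * (Q * Q)) i : ℝ) : ℂ) * ((U₀ * E)ᴴ * (U₀ * E)).det := by
    intro P Q hP hQ
    have hPd := (isUnit_iff_isUnit_det _).1 hP.isUnit
    have hsq : ∀ {M : Matrix (Fin n) (Fin n) ℂ}, M.PosDef → (M * M).PosDef := fun {M} hM => by
      have := PosDef.conjTranspose_mul_self M (mulVec_injective_of_isUnit hM.isUnit)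
      rwa [hM.1.eq] at this
    have h := det_compression_le k (hsq hQ) (hsq hP) (hinj (P * U₀) (hP.isUnit.mul hU₀u))
    rw [eig_mul_comm] at h
    have h1 : (P * U₀ * E)ᴴ * (Q * Q) * (P * U₀ * E) =
        (Q * P * (U₀ * E))ᴴ * (Q * P * (U₀ * E)) := by
      simp only [conjTranspose_mul, hP.1.eq, hQ.1.eq, Matrix.mul_assoc]
    have h2 : (P * U₀ * E)ᴴ * (P * P)⁻¹ * (P * U₀ * E) = (U₀ * E)ᴴ * (U₀ * E) := by
      calc _ = (U₀ * E)ᴴ * ((P * P⁻¹) * (P⁻¹ * P)) * (U₀ * E) := by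
            simp only [conjTranspose_mul, hP.1.eq, Matrix.mul_inv_rev, Matrix.mul_assoc]
        _ = _ := by rw [mul_nonsing_inv _ hPd, nonsing_inv_mul _ hPd, Matrix.mul_one, Matrix.mul_one]
    rwa [h1, h2] at h
  have hX : Function.Injective (Q₂ * P₂ * (U₀ * E)).mulVec := by
    rw [← Matrix.mul_assoc]
    exact hinj _ ((hQ₂.isUnit.mul hP₂.isUnit).mul hU₀u)
  have hCS := det_conjTranspose_mul_le (Y := Q₁ * P₁ * (U₀ * E)) hX
  have hXY : (Q₂ * P₂ * (U₀ * E))ᴴ * (Q₁ * P₁ * (U₀ * E)) = (U₀ * E)ᴴ * (U₀ * E) *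
      diagonal (fun i : {i : Fin n // i ≤ k} => (d i : ℂ)) := by
    calc _ = (U₀ * E)ᴴ * (P₂ * Q₂ * Q₁ * P₁ * U₀) * E := by
          rw [conjTranspose_mul (Q₂ * P₂), conjTranspose_mul Q₂, hP₂.1.eq, hQ₂.1.eq]
          simp only [Matrix.mul_assoc]
      _ = (U₀ * E)ᴴ * U₀ * (D * E) := by rw [hU₀]; simp only [Matrix.mul_assoc]
      _ = _ := by rw [hDE]; simp only [Matrix.mul_assoc]
  have hg : 0 < ((U₀ * E)ᴴ * (U₀ * E)).det :=
    (PosDef.conjTranspose_mul_self _ (hinj U₀ hU₀u)).det_pos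
  obtain ⟨g, hg0, hgeq⟩ : ∃ g : ℝ, 0 < g ∧ ((U₀ * E)ᴴ * (U₀ * E)).det = (g : ℂ) := by
    refine ⟨((U₀ * E)ᴴ * (U₀ * E)).det.re, (Complex.lt_def.1 hg).1, ?_⟩
    exact Complex.ext rfl (by simpa using (Complex.lt_def.1 hg).2.symm)
  have h₁ := hbound hP₁ hQ₁
  have h₂ := hbound hP₂ hQ₂
  have hdet : ((Q₂ * P₂ * (U₀ * E))ᴴ * (Q₁ * P₁ * (U₀ * E))).det =
      ((g * ∏ i ∈ Finset.Iic k, d i : ℝ) : ℂ) := by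
    rw [hXY, det_mul, det_diagonal, hgeq, prod_Iic_eq k (fun i => (d i : ℂ))]
    push_cast; rfl
  rw [hdet] at hCS
  rw [hgeq] at h₁ h₂
  have h0 : ∀ X : Matrix (Fin n) {i : Fin n // i ≤ k} ℂ, 0 ≤ (Xᴴ * X).det := fun X =>
    (posSemidef_conjTranspose_mul_self X).det_nonneg
  have hfin := hCS.trans (mul_le_mul h₂ h₁ (h0 _) ((h0 _).trans h₂))
  rw [Complex.star_def, Complex.conj_ofReal] at hfin
  have hreal : (g * ∏ i ∈ Finset.Iic k, d i) * (g * ∏ i ∈ Finset.Iic k, d i) ≤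
      (∏ i ∈ Finset.Iic k, eig (P₂ * P₂ * (Q₂ * Q₂)) i) * g *
        ((∏ i ∈ Finset.Iic k, eig (P₁ * P₁ * (Q₁ * Q₁)) i) * g) := by exact_mod_cast hfin
  refine le_of_mul_le_mul_left ?_ (mul_pos hg0 hg0)
  linarith

/-! ### Scalar convexity -/

/-- A midpoint convex function on `[0, 1]` that is bounded above and nonpositive at the endpoints
is nonpositive. -/
theorem nonpos_of_midpoint_convex {φ : ℝ → ℝ} {b : ℝ} (h0 : φ 0 ≤ 0) (h1 : φ 1 ≤ 0)
    (hb : ∀ x ∈ Set.Icc (0 : ℝ) 1, φ x ≤ b)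
    (hmid : ∀ x ∈ Set.Icc (0 : ℝ) 1, ∀ y ∈ Set.Icc (0 : ℝ) 1, φ ((x + y) / 2) ≤ (φ x + φ y) / 2)
    {x : ℝ} (hx : x ∈ Set.Icc (0 : ℝ) 1) : φ x ≤ 0 := by
  set s := sSup (φ '' Set.Icc 0 1)
  have hbdd : BddAbove (φ '' Set.Icc 0 1) := ⟨b, by rintro _ ⟨y, hy, rfl⟩; exact hb y hy⟩
  have hle : ∀ y ∈ Set.Icc (0 : ℝ) 1, φ y ≤ s := fun y hy => le_csSup hbdd ⟨y, hy, rfl⟩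
  -- Each point is the midpoint of an endpoint and another point of [0, 1]. So the supremum s
  -- satisfies s ≤ s/2, which forces s ≤ 0.
  have hhalf : ∀ y ∈ Set.Icc (0 : ℝ) 1, φ y ≤ s / 2 := by
    intro y hy
    rcases le_total y (1 / 2) with h | h
    · have hy2 : 2 * y ∈ Set.Icc (0 : ℝ) 1 := ⟨by linarith [hy.1], by linarith⟩
      have := hmid 0 (by simp) (2 * y) hy2
      rw [show (0 + 2 * y) / 2 = y by ring] at this
      linarith [hle _ hy2]
    · have hy2 : 2 * y - 1 ∈ Set.Icc (0 : ℝ) 1 := ⟨by linarith, by linarith [hy.2]⟩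
      have := hmid 1 (by simp) (2 * y - 1) hy2
      rw [show (1 + (2 * y - 1)) / 2 = y by ring] at this
      linarith [hle _ hy2]
  have : s ≤ s / 2 := csSup_le ⟨φ 0, 0, by simp, rfl⟩ (by rintro _ ⟨y, hy, rfl⟩; exact hhalf y hy)
  linarith [hle x hx]

/-- On a finite set, a concave, nondecreasing and nonexpansive function is a constant plus a
sub-convex combination of the functions `t ↦ min t s`. -/
theorem exists_eq_sum_min {D : Set ℝ} {F : ℝ → ℝ}
    (hconc : ∀ x ∈ D, ∀ y ∈ D, ∀ z ∈ D, x < y → y < z →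
      (F z - F y) * (y - x) ≤ (F y - F x) * (z - y))
    (hmono : ∀ x ∈ D, ∀ y ∈ D, x ≤ y → F x ≤ F y)
    (hlip : ∀ x ∈ D, ∀ y ∈ D, x ≤ y → F y - F x ≤ y - x) (S : Finset ℝ) :
    (∀ s ∈ S, s ∈ D) → ∃ (c : ℝ) (w : ℝ → ℝ), (∀ s, 0 ≤ w s) ∧ ∑ s ∈ S, w s ≤ 1 ∧
      (∀ t ∈ S, F t = c + ∑ s ∈ S, w s * min t s) ∧
      (∀ u ∈ D, S.Nonempty → (∀ t ∈ S, u < t) → F u ≤ c + (∑ s ∈ S, w s) * u) := by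
  -- Points are added from the right to the left. The last clause, that the leftmost line continued
  -- to the left stays above F, makes the next weight nonnegative.
  induction S using Finset.induction_on_min with
  | empty => exact fun _ => ⟨0, 0, by simp, by simp, by simp, by simp⟩
  | insert t₀ S ht₀ ih =>
    intro hS
    have ht₀D : t₀ ∈ D := hS _ (Finset.mem_insert_self _ _)
    have ht₀S : t₀ ∉ S := fun h => lt_irrefl _ (ht₀ _ h)
    rcases S.eq_empty_or_nonempty with rfl | hne
    · refine ⟨F t₀, 0, by simp, by simp, by simp, fun u hu _ hut => ?_⟩
      simpa using hmono u hu t₀ ht₀D (hut t₀ (by simp)).le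
    · obtain ⟨c, w, hw0, hw1, hF, hleft⟩ := ih fun s hs => hS s (Finset.mem_insert_of_mem hs)
      set W := ∑ s ∈ S, w s
      set t₁ := S.min' hne
      have ht₁S : t₁ ∈ S := S.min'_mem hne
      have ht₁D : t₁ ∈ D := hS _ (Finset.mem_insert_of_mem ht₁S)
      have ht₁ : ∀ s ∈ S, t₁ ≤ s := fun s hs => S.min'_le s hs
      have h01 : t₀ < t₁ := ht₀ _ ht₁S
      have hd : 0 < t₁ - t₀ := sub_pos.2 h01
      have hmin : ∀ t ≤ t₁, ∑ s ∈ S, w s * min t s = W * t := fun t ht => by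
        rw [Finset.sum_mul]
        exact Finset.sum_congr rfl fun s hs => by rw [min_eq_left (ht.trans (ht₁ s hs))]
      have hFt₁ : F t₁ = c + W * t₁ := by rw [hF t₁ ht₁S, hmin t₁ le_rfl]
      have hFt₀ : F t₀ ≤ c + W * t₀ := hleft t₀ ht₀D hne ht₀
      set σ := (F t₁ - F t₀) / (t₁ - t₀)
      have hσ : σ * (t₁ - t₀) = F t₁ - F t₀ := div_mul_cancel₀ _ hd.ne'
      have hWσ : W ≤ σ := by
        rw [le_div_iff₀ hd]; linarith
      have hσ1 : σ ≤ 1 := by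
        rw [div_le_one hd]; exact hlip _ ht₀D _ ht₁D h01.le
      -- The slope left of t₁ must rise from W to σ. Weight σ − W at t₁ does this, and lowering c by
      -- (σ − W)t₁ keeps the values from t₁ on unchanged. The new leftmost point t₀ gets weight 0.
      let w' : ℝ → ℝ := fun s => (if s = t₀ then 0 else w s) + if s = t₁ then σ - W else 0
      have hsum : ∀ g : ℝ → ℝ, ∑ s ∈ insert t₀ S, w' s * g s =
          ∑ s ∈ S, w s * g s + (σ - W) * g t₁ := by
        intro g
        rw [Finset.sum_insert ht₀S]
        have h1 : w' t₀ = 0 := by simp [w', h01.ne]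
        have h2 : ∀ s ∈ S, w' s * g s = w s * g s + if s = t₁ then (σ - W) * g t₁ else 0 := by
          intro s hs
          have : s ≠ t₀ := (ht₀ s hs).ne'
          by_cases h : s = t₁
          · simp [w', h, h01.ne']; ring
          · simp [w', this, h]
        rw [h1, Finset.sum_congr rfl h2, Finset.sum_add_distrib, Finset.sum_ite_eq']
        simp [ht₁S]
      have hsum1 : ∑ s ∈ insert t₀ S, w' s = σ := by
        have := hsum fun _ => 1
        simp only [mul_one] at this
        rw [this]; ring
      refine ⟨c - (σ - W) * t₁, w', fun s => ?_, hsum1.trans_le hσ1, fun t ht => ?_,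
        fun u hu _ hut => ?_⟩
      · have h1 : 0 ≤ if s = t₀ then 0 else w s := by split_ifs <;> simp [hw0]
        have h2 : 0 ≤ if s = t₁ then σ - W else 0 := by split_ifs <;> simp [hWσ]
        exact add_nonneg h1 h2
      · rw [hsum fun s => min t s]
        rcases Finset.mem_insert.1 ht with rfl | htS
        · rw [hmin _ h01.le, min_eq_left h01.le]
          linear_combination hFt₁ + hσ
        · rw [hF t htS, min_eq_right (ht₁ t htS)]; ring
      · rw [hsum1]
        have hut₀ := hut t₀ (Finset.mem_insert_self _ _)
        have h1 := hconc u hu t₀ ht₀D t₁ ht₁D hut₀ h01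
        rw [← hσ] at h1
        have h2 : σ * (t₀ - u) ≤ F t₀ - F u := by
          refine le_of_mul_le_mul_right ?_ hd
          linarith
        linarith

/-! ### Functional calculus and the convex set of good exponents -/

/-- The functional calculus of `exp ∘ G`. -/
noncomputable def cfcExp {n : ℕ} (G : ℝ → ℝ) (A : Matrix (Fin n) (Fin n) ℂ) :
    Matrix (Fin n) (Fin n) ℂ :=
  cfc (fun x => Real.exp (G x)) A

section FunctionalCalculus

variable {n : ℕ} {A B : Matrix (Fin n) (Fin n) ℂ}

theorem continuousOn_spectrum (A : Matrix (Fin n) (Fin n) ℂ) (f : ℝ → ℝ) :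
    ContinuousOn f (spectrum ℝ A) :=
  A.finite_real_spectrum.continuousOn f

theorem cfcExp_add (G H : ℝ → ℝ) (A : Matrix (Fin n) (Fin n) ℂ) :
    cfcExp (G + H) A = cfcExp G A * cfcExp H A := by
  rw [cfcExp, cfcExp, cfcExp, ← cfc_mul _ _ A (continuousOn_spectrum A _) (continuousOn_spectrum A _)]
  simp [Real.exp_add]

theorem cfcExp_const (hA : A.IsHermitian) (c : ℝ) :
    cfcExp (fun _ => c) A = ((Real.exp c : ℝ) : ℂ) • (1 : Matrix (Fin n) (Fin n) ℂ) := by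
  rw [cfcExp, cfc_const _ A hA.isSelfAdjoint, Algebra.algebraMap_eq_smul_one]
  ext i j
  simp

theorem cfcExp_isHermitian (G : ℝ → ℝ) (A : Matrix (Fin n) (Fin n) ℂ) :
    (cfcExp G A).IsHermitian :=
  (cfc_predicate (p := IsSelfAdjoint) (fun x => Real.exp (G x)) A).star_eq

theorem cfcExp_posDef (hA : A.IsHermitian) (G : ℝ → ℝ) : (cfcExp G A).PosDef := by
  set H : ℝ → ℝ := fun x => G x / 2
  have h1 : cfcExp H A * cfcExp (-H) A = 1 := by
    rw [← cfcExp_add, show H + -H = fun _ => 0 by ext; simp, cfcExp_const hA]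
    simp
  have h2 : cfcExp G A = (cfcExp H A)ᴴ * cfcExp H A := by
    rw [(cfcExp_isHermitian H A).eq, ← cfcExp_add]
    congr 1
    ext x
    simp [H]
  rw [h2]
  exact PosDef.conjTranspose_mul_self _
    (mulVec_injective_of_isUnit (IsUnit.of_mul_eq_one _ h1))

theorem cfcExp_mono {G H : ℝ → ℝ} (h : ∀ x ∈ spectrum ℝ A, G x ≤ H x) :
    (cfcExp H A - cfcExp G A).PosSemidef := by
  open scoped MatrixOrder in
  exact Matrix.le_iff.1 (cfc_mono (fun x hx => Real.exp_le_exp.2 (h x hx))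
    (continuousOn_spectrum A _) (continuousOn_spectrum A _))

theorem spectrum_pos (hA : A.PosDef) {x : ℝ} (hx : x ∈ spectrum ℝ A) : 0 < x := by
  rw [hA.1.spectrum_real_eq_range_eigenvalues] at hx
  obtain ⟨i, rfl⟩ := hx
  exact hA.eigenvalues_pos i

theorem cfcExp_log_add_const (hA : A.PosDef) (c : ℝ) :
    cfcExp (fun x => Real.log x + c) A = ((Real.exp c : ℝ) : ℂ) • A := by
  have h1 : cfcExp Real.log A = A := by
    rw [cfcExp]
    conv_rhs => rw [← cfc_id ℝ A hA.1.isSelfAdjoint]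
    exact cfc_congr fun x hx => by simp [Real.exp_log (spectrum_pos hA hx)]
  have h2 := cfcExp_add Real.log (fun _ => c) A
  rw [h1, cfcExp_const hA.1] at h2
  simpa [Pi.add_def] using h2

/-- The exponents `G` for which `exp ∘ G` satisfies the `k`-th weak log-submajorisation inequality
for the pair `A`, `B`. -/
def goodExponents (k : Fin n) (A B : Matrix (Fin n) (Fin n) ℂ) : Set (ℝ → ℝ) :=
  {G | ∏ j ∈ Finset.Iic k, eig (cfcExp G A * cfcExp G B) j ≤
    ∏ j ∈ Finset.Iic k, Real.exp (2 * G (√(eig (A * B) j)))}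

theorem mem_goodExponents_of_forall {k : Fin n} (hA : A.IsHermitian) (hB : B.IsHermitian)
    {G : ℝ → ℝ}
    (h : ∀ j, eig (cfcExp G A * cfcExp G B) j ≤ Real.exp (2 * G (√(eig (A * B) j)))) :
    G ∈ goodExponents k A B :=
  Finset.prod_le_prod (fun j _ => (eig_mul_pos (cfcExp_posDef hA G) (cfcExp_posDef hB G) j).le)
    fun j _ => h j

theorem eig_cfcExp_const (hA : A.IsHermitian) (hB : B.IsHermitian) (c : ℝ) (j : Fin n) :
    eig (cfcExp (fun _ => c) A * cfcExp (fun _ => c) B) j = Real.exp (2 * c) := by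
  rw [cfcExp_const hA, cfcExp_const hB, smul_mul_smul_comm, one_mul, ← Complex.ofReal_mul,
    eig_smul_one, ← Real.exp_add, two_mul]

theorem const_mem_goodExponents (k : Fin n) (hA : A.IsHermitian) (hB : B.IsHermitian) (c : ℝ) :
    (fun _ => c) ∈ goodExponents k A B :=
  mem_goodExponents_of_forall hA hB fun j => (eig_cfcExp_const hA hB c j).le

theorem eig_cfcExp_mono (hA : A.IsHermitian) (hB : B.IsHermitian) {G H : ℝ → ℝ}
    (h : ∀ x ∈ spectrum ℝ A, G x ≤ H x) (h' : ∀ x ∈ spectrum ℝ B, G x ≤ H x) (j : Fin n) :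
    eig (cfcExp G A * cfcExp G B) j ≤ eig (cfcExp H A * cfcExp H B) j :=
  eig_mul_mono (cfcExp_posDef hA G) (cfcExp_posDef hA H) (cfcExp_posDef hB G)
    (cfcExp_posDef hB H) (cfcExp_mono h) (cfcExp_mono h') j

/-- The exponent lies below the constant s + c and below log x + c. For both of these the inequality
is an equality for each eigenvalue, so monotonicity yields both bounds and hence their minimum. -/
theorem min_log_mem_goodExponents (k : Fin n) (hA : A.PosDef) (hB : B.PosDef) (s c : ℝ) :
    (fun x => min (Real.log x) s + c) ∈ goodExponents k A B := by
  refine mem_goodExponents_of_forall hA.1 hB.1 fun j => ?_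
  have hpos := eig_mul_pos hA hB j
  have h1 : eig (cfcExp (fun x => min (Real.log x) s + c) A *
      cfcExp (fun x => min (Real.log x) s + c) B) j ≤ Real.exp (2 * (s + c)) := by
    rw [← eig_cfcExp_const hA.1 hB.1 (s + c) j]
    exact eig_cfcExp_mono hA.1 hB.1 (fun x _ => by gcongr; exact min_le_right _ _)
      (fun x _ => by gcongr; exact min_le_right _ _) j
  have h2 : eig (cfcExp (fun x => min (Real.log x) s + c) A *
      cfcExp (fun x => min (Real.log x) s + c) B) j ≤
      Real.exp (2 * (Real.log (√(eig (A * B) j)) + c)) := by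
    refine (eig_cfcExp_mono hA.1 hB.1 (H := fun x => Real.log x + c)
      (fun x _ => by gcongr; exact min_le_left _ _)
      (fun x _ => by gcongr; exact min_le_left _ _) j).trans_eq ?_
    rw [cfcExp_log_add_const hA, cfcExp_log_add_const hB, smul_mul_smul_comm, ← Complex.ofReal_mul,
      eig_smul hA.1 hB (by positivity), Real.log_sqrt hpos.le,
      show 2 * (Real.log (eig (A * B) j) / 2 + c) = c + c + Real.log (eig (A * B) j) by ring,
      Real.exp_add, Real.exp_add, Real.exp_log hpos]
  rcases le_total (Real.log (√(eig (A * B) j))) s with h | h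
  · simpa [min_eq_left h] using h2
  · simpa [min_eq_right h] using h1

/-- Membership means ψ ≤ 0, where ψ is the log of the left side minus a linear functional. Since ψ
is midpoint convex and bounded above along segments, it is nonpositive between two members. -/
theorem convex_goodExponents (k : Fin n) (hA : A.IsHermitian) (hB : B.IsHermitian) :
    Convex ℝ (goodExponents k A B) := by
  have hpos : ∀ G j, 0 < eig (cfcExp G A * cfcExp G B) j := fun G j =>
    eig_mul_pos (cfcExp_posDef hA G) (cfcExp_posDef hB G) j
  set T : (ℝ → ℝ) → ℝ := fun G => ∏ j ∈ Finset.Iic k, eig (cfcExp G A * cfcExp G B) j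
  have hT : ∀ G, 0 < T G := fun G => Finset.prod_pos fun j _ => hpos G j
  have hTmono : ∀ {G H : ℝ → ℝ}, (∀ x, G x ≤ H x) → T G ≤ T H := fun {G H} h =>
    Finset.prod_le_prod (fun j _ => (hpos G j).le)
      fun j _ => eig_cfcExp_mono hA hB (fun x _ => h x) (fun x _ => h x) j
  set ψ : (ℝ → ℝ) → ℝ := fun G => Real.log (T G) -
    ∑ j ∈ Finset.Iic k, 2 * G (√(eig (A * B) j))
  have hmem : ∀ G, G ∈ goodExponents k A B ↔ ψ G ≤ 0 := by
    intro G
    rw [sub_nonpos, Real.log_le_iff_le_exp (hT G), Real.exp_sum]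
    rfl
  have hψmid : ∀ G H : ℝ → ℝ, ψ (fun x => (G x + H x) / 2) ≤ (ψ G + ψ H) / 2 := by
    intro G H
    set G' : ℝ → ℝ := fun x => G x / 2
    set H' : ℝ → ℝ := fun x => H x / 2
    have e1 : (fun x => (G x + H x) / 2) = G' + H' := by ext x; simp [G', H']; ring
    have e2 : (fun x => (G x + H x) / 2) = H' + G' := by ext x; simp [G', H']; ring
    have e3 : G = G' + G' := by ext x; simp [G']
    have e4 : H = H' + H' := by ext x; simp [H']
    have hsq : T (fun x => (G x + H x) / 2) ^ 2 ≤ T G * T H := by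
      -- The factors are e^{G/2} and e^{H/2} at A and at B. Those at the same matrix commute, so
      -- their products are again positive definite.
      have h := sq_prod_eig_mul_le k (cfcExp_posDef hA G') (cfcExp_posDef hA H')
        (cfcExp_posDef hB G') (cfcExp_posDef hB H')
        (by rw [← cfcExp_add]; exact cfcExp_posDef hA _)
        (by rw [← cfcExp_add]; exact cfcExp_posDef hB _)
      simp only [← cfcExp_add] at h
      rwa [← e1, ← e2, ← e3, ← e4] at h
    have hlog := Real.log_le_log (pow_pos (hT _) 2) hsq
    rw [Real.log_pow, Real.log_mul (hT G).ne' (hT H).ne'] at hlog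
    have hlin : ∑ j ∈ Finset.Iic k, 2 * ((G (√(eig (A * B) j)) + H (√(eig (A * B) j))) / 2) =
        (∑ j ∈ Finset.Iic k, 2 * G (√(eig (A * B) j)) +
          ∑ j ∈ Finset.Iic k, 2 * H (√(eig (A * B) j))) / 2 := by
      rw [← Finset.sum_add_distrib, Finset.sum_div]
      exact Finset.sum_congr rfl fun j _ => by ring
    simp only [ψ]
    rw [hlin]
    push_cast at hlog
    linarith
  rw [convex_iff_forall_pos]
  intro G hG H hH a b ha hb hab
  rw [hmem] at hG hH ⊢
  set K : ℝ → ℝ → ℝ := fun w x => (1 - w) * G x + w * H x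
  have hK : a • G + b • H = K b := by
    ext x; simp [K, ← hab]
  rw [hK]
  -- Along the segment the exponent lies between min(G, H) and max(G, H), which gives the upper
  -- bound `b`.
  refine nonpos_of_midpoint_convex (φ := fun w => ψ (K w))
    (b := Real.log (T fun x => max (G x) (H x)) -
      ∑ j ∈ Finset.Iic k, 2 * min (G (√(eig (A * B) j))) (H (√(eig (A * B) j)))) ?_ ?_ ?_ ?_
    ⟨hb.le, by linarith⟩
  · simpa [K] using hG
  · simpa [K] using hH
  · intro w hw
    have hw0 := hw.1
    have hw1 : 0 ≤ 1 - w := sub_nonneg.2 hw.2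
    have hup : ∀ x, K w x ≤ max (G x) (H x) := fun x => by
      nlinarith [le_max_left (G x) (H x), le_max_right (G x) (H x)]
    have hlow : ∀ x, min (G x) (H x) ≤ K w x := fun x => by
      nlinarith [min_le_left (G x) (H x), min_le_right (G x) (H x)]
    refine sub_le_sub (Real.log_le_log (hT _) (hTmono hup)) (Finset.sum_le_sum fun j _ => ?_)
    exact mul_le_mul_of_nonneg_left (hlow _) zero_le_two
  · intro x _ y _
    have : K ((x + y) / 2) = fun z => (K x z + K y z) / 2 := by ext z; simp [K]; ring
    simp only [this]
    exact hψmid _ _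

theorem sum_min_log_mem_goodExponents (k : Fin n) (hA : A.PosDef) (hB : B.PosDef) (c : ℝ)
    {w : ℝ → ℝ} (hw : ∀ s, 0 ≤ w s) {S : Finset ℝ} (hS : ∑ s ∈ S, w s ≤ 1) :
    (fun x => c + ∑ s ∈ S, w s * min (Real.log x) s) ∈ goodExponents k A B := by
  -- The index `none` gives the remaining weight 1 − ∑ w_s to the constant c. Every generator
  -- carries + c, so the constants add up to c.
  let v : Option ℝ → ℝ := fun o => o.elim (1 - ∑ s ∈ S, w s) w
  let g : Option ℝ → ℝ → ℝ := fun o => o.elim (fun _ => c) fun s x => min (Real.log x) s + c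
  have h := (convex_goodExponents k hA.1 hB.1).sum_mem (t := S.insertNone) (w := v) (z := g)
    (by
      rintro (_ | s) _
      · exact sub_nonneg.2 hS
      · exact hw s)
    (by rw [Finset.sum_insertNone]; simp [v])
    (by
      rintro (_ | s) _
      · exact const_mem_goodExponents k hA.1 hB.1 c
      · exact min_log_mem_goodExponents k hA hB s c)
  convert h using 1
  ext x
  rw [Finset.sum_insertNone]
  simp [v, g, mul_add, Finset.sum_add_distrib, ← Finset.sum_mul]
  ring

end FunctionalCalculus

open Set Filter Topology

/-! ### Concave functions on an interval -/

section Concave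

variable {p q : ℝ} {F : ℝ → ℝ}

/-- A concave function is locally Lipschitz, hence differentiable almost everywhere and so on a
dense set. -/
theorem exists_differentiableAt_of_concaveOn (hF : ConcaveOn ℝ (Ioo p q) F) {u v : ℝ}
    (hu : p ≤ u) (huv : u < v) (hv : v ≤ q) : ∃ t ∈ Ioo u v, DifferentiableAt ℝ F t := by
  set m := (u + v) / 2
  have hm : m ∈ Ioo u v := ⟨by simp only [m]; linarith, by simp only [m]; linarith⟩
  have hsub : Ioo u v ⊆ Ioo p q := Ioo_subset_Ioo hu hv
  obtain ⟨K, U, hU, hLip⟩ := hF.locallyLipschitzOn isOpen_Ioo (hsub hm)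
  rw [isOpen_Ioo.nhdsWithin_eq (hsub hm)] at hU
  have hU' : U ∩ Ioo u v ∈ 𝓝 m := inter_mem hU (isOpen_Ioo.mem_nhds hm)
  set V := interior (U ∩ Ioo u v)
  have hmV : m ∈ V := mem_interior_iff_mem_nhds.2 hU'
  have hVsub : V ⊆ U ∩ Ioo u v := interior_subset
  have hae := (hLip.mono (hVsub.trans inter_subset_left)).ae_differentiableWithinAt_of_mem_real
  have hdense := MeasureTheory.Measure.dense_of_ae hae
  obtain ⟨t, htV, ht⟩ := hdense.inter_open_nonempty V isOpen_interior ⟨m, hmV⟩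
  exact ⟨t, (hVsub htV).2, (ht htV).differentiableAt (isOpen_interior.mem_nhds htV)⟩

/-- Chord minus function is midpoint convex, zero at both ends, and bounded by compactness. -/
theorem concaveOn_of_midpoint (hc : ContinuousOn F (Ioo p q))
    (hmid : ∀ x ∈ Ioo p q, ∀ y ∈ Ioo p q, (F x + F y) / 2 ≤ F ((x + y) / 2)) :
    ConcaveOn ℝ (Ioo p q) F := by
  refine ⟨convex_Ioo p q, fun x hx y hy a b ha hb hab => ?_⟩
  have hseg : ∀ w ∈ Icc (0 : ℝ) 1, (1 - w) * x + w * y ∈ Ioo p q := fun w hw =>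
    convex_Ioo p q hx hy (sub_nonneg.2 hw.2) hw.1 (by ring)
  set φ : ℝ → ℝ := fun w => (1 - w) * F x + w * F y - F ((1 - w) * x + w * y)
  have hφ : ContinuousOn φ (Icc 0 1) := by
    refine ContinuousOn.sub (by fun_prop) ?_
    exact hc.comp (by fun_prop) hseg
  obtain ⟨M, hM⟩ := isCompact_Icc.bddAbove_image hφ
  have h := nonpos_of_midpoint_convex (φ := φ) (b := M) (by simp [φ]) (by simp [φ])
    (fun w hw => hM ⟨w, hw, rfl⟩)
    (fun w hw w' hw' => by
      have := hmid _ (hseg w hw) _ (hseg w' hw')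
      rw [show ((1 - w) * x + w * y + ((1 - w') * x + w' * y)) / 2 =
        (1 - (w + w') / 2) * x + (w + w') / 2 * y by ring] at this
      simp only [φ]
      linarith) (x := b) ⟨hb, by linarith⟩
  have ha' : 1 - b = a := by linarith
  simp only [φ, ha'] at h
  simp only [smul_eq_mul]
  linarith

/-- Chord slopes decrease, so the slope over [u, v] lies between a derivative at some point right of
v and one at some point left of u. Differentiability at u or v is not needed. -/
theorem concaveOn_increment_bounds (hF : ConcaveOn ℝ (Ioo p q) F)
    (hd : ∀ t ∈ Ioo p q, ∀ F', HasDerivAt F F' t → 0 ≤ F' ∧ F' ≤ 1) {u v : ℝ}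
    (hu : u ∈ Ioo p q) (hv : v ∈ Ioo p q) (huv : u ≤ v) : F u ≤ F v ∧ F v - F u ≤ v - u := by
  rcases huv.eq_or_lt with rfl | huv
  · simp
  have hvu : 0 < v - u := sub_pos.2 huv
  constructor
  · obtain ⟨t, ht, htd⟩ := exists_differentiableAt_of_concaveOn hF hv.1.le hv.2 le_rfl
    have htm : t ∈ Ioo p q := ⟨hv.1.trans ht.1, ht.2⟩
    have h1 := (hd t htm _ htd.hasDerivAt).1
    have h2 := hF.le_slope_of_hasDerivAt hv htm ht.1 htd.hasDerivAt
    have h3 := hF.slope_anti_adjacent hu htm huv ht.1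
    rw [slope_def_field] at h2
    have h4 := h1.trans (h2.trans h3)
    have h5 := mul_nonneg h4 hvu.le
    rw [div_mul_cancel₀ _ hvu.ne'] at h5
    linarith
  · obtain ⟨t, ht, htd⟩ := exists_differentiableAt_of_concaveOn hF le_rfl hu.1 hu.2.le
    have htm : t ∈ Ioo p q := ⟨ht.1, ht.2.trans hu.2⟩
    have h1 := (hd t htm _ htd.hasDerivAt).2
    have h2 := hF.slope_le_of_hasDerivAt htm hu ht.2 htd.hasDerivAt
    have h3 := hF.slope_anti_adjacent htm hv ht.2 huv
    rw [slope_def_field] at h2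
    have h4 := h3.trans (h2.trans h1)
    rwa [div_le_one hvu] at h4

end Concave

/-! ### Class 𝒜 in logarithmic coordinates -/

section ClassA

variable {x₀ : EReal} {f : ℝ → ℝ}

theorem mem_dom_of_le {x y : ℝ} (hx : 0 ≤ x) (hxy : x ≤ y) (hy : y ∈ dom x₀) : x ∈ dom x₀ :=
  ⟨hx, lt_of_le_of_lt (by exact_mod_cast hxy) hy.2⟩

theorem exists_gt_mem_dom {x : ℝ} (hx : x ∈ dom x₀) : ∃ y ∈ dom x₀, x < y := by
  obtain ⟨y, h1, h2⟩ := EReal.lt_iff_exists_real_btwn.1 hx.2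
  have hxy : x < y := by exact_mod_cast h1
  exact ⟨y, ⟨hx.1.trans hxy.le, h2⟩, hxy⟩

theorem dom_mem_nhds {x : ℝ} (hx : x ∈ dom x₀) (h0 : 0 < x) : dom x₀ ∈ 𝓝 x := by
  obtain ⟨y, hy, hxy⟩ := exists_gt_mem_dom hx
  exact mem_of_superset (Ioo_mem_nhds h0 hxy) fun z hz => mem_dom_of_le hz.1.le hz.2.le hy

theorem sqrt_mul_mem_dom {x y : ℝ} (hx : x ∈ dom x₀) (hy : y ∈ dom x₀) : √(x * y) ∈ dom x₀ := by
  have hm : max x y ∈ dom x₀ := by rcases max_choice x y with h | h <;> rw [h] <;> assumption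
  refine mem_dom_of_le (Real.sqrt_nonneg _) (Real.sqrt_le_iff.2 ⟨hx.1.trans (le_max_left _ _), ?_⟩) hm
  rw [sq]
  exact mul_le_mul (le_max_left _ _) (le_max_right _ _) hy.1 (hx.1.trans (le_max_left _ _))

theorem ClassA.continuousAt_comp_exp (h : ClassA x₀ f) {t : ℝ} (ht : Real.exp t ∈ dom x₀) :
    ContinuousAt (fun t => f (Real.exp t)) t :=
  ContinuousAt.comp (f := Real.exp) (g := f) (h.continuousOn.continuousAt (dom_mem_nhds ht (Real.exp_pos t)))
    Real.continuous_exp.continuousAt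

/-- On an interval where `f ∘ exp` is positive, `log ∘ f ∘ exp` is concave with slopes in
`[0, 1]`. -/
theorem ClassA.log_comp_exp (h : ClassA x₀ f) {p q : ℝ}
    (hdom : ∀ t ∈ Ioo p q, Real.exp t ∈ dom x₀) (hpos : ∀ t ∈ Ioo p q, 0 < f (Real.exp t)) :
    ConcaveOn ℝ (Ioo p q) (fun t => Real.log (f (Real.exp t))) ∧
      ∀ u ∈ Ioo p q, ∀ v ∈ Ioo p q, u ≤ v →
        Real.log (f (Real.exp u)) ≤ Real.log (f (Real.exp v)) ∧
          Real.log (f (Real.exp v)) - Real.log (f (Real.exp u)) ≤ v - u := by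
  have hconc : ConcaveOn ℝ (Ioo p q) (fun t => Real.log (f (Real.exp t))) := by
    refine concaveOn_of_midpoint (fun t ht => ?_) fun x hx y hy => ?_
    · exact ((h.continuousAt_comp_exp (hdom t ht)).log (hpos t ht).ne').continuousWithinAt
    · have hg := h.geometricallyConcave _ (hdom x hx) _ (hdom y hy)
      have he : √(Real.exp x * Real.exp y) = Real.exp ((x + y) / 2) := by
        rw [← Real.exp_add, Real.exp_half]
      rw [he] at hg
      have hl := Real.log_le_log (Real.sqrt_pos.2 (mul_pos (hpos x hx) (hpos y hy))) hg
      rwa [Real.log_sqrt (mul_pos (hpos x hx) (hpos y hy)).le,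
        Real.log_mul (hpos x hx).ne' (hpos y hy).ne'] at hl
  refine ⟨hconc, fun u hu v hv huv => concaveOn_increment_bounds hconc (fun t ht F' hF' => ?_)
    hu hv huv⟩
  set x := Real.exp t
  have hx0 : 0 < x := Real.exp_pos t
  have hlog : Real.log x = t := Real.log_exp t
  -- Near x = e^t, f(y) = exp(F(log y)), so x f'(x) = f(x) F'(t). The class bounds become 0 ≤ F' ≤
  -- 1.
  have h1 : HasDerivAt (fun y => Real.exp (Real.log (f (Real.exp (Real.log y)))))
      (f x * (F' * x⁻¹)) x := by
    have h2 : HasDerivAt (fun y => Real.log (f (Real.exp (Real.log y)))) (F' * x⁻¹) x := by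
      have h3 := Real.hasDerivAt_log hx0.ne'
      rw [← hlog] at hF'
      exact hF'.comp x h3
    have h4 := h2.exp
    rwa [hlog, Real.exp_log (hpos t ht)] at h4
  have h5 : (fun y => Real.exp (Real.log (f (Real.exp (Real.log y))))) =ᶠ[𝓝 x] f := by
    have h6 : ∀ᶠ y in 𝓝 x, Real.log y ∈ Ioo p q :=
      (Real.continuousAt_log hx0.ne').eventually (isOpen_Ioo.mem_nhds (by rwa [hlog]))
    filter_upwards [h6, lt_mem_nhds hx0] with y hy hy0
    rw [Real.exp_log (hpos _ hy), Real.exp_log hy0]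
  have h7 := h.deriv_bounds x (hdom t ht) _ (h1.congr_of_eventuallyEq h5.symm).hasDerivWithinAt
  have h8 : x * (f x * (F' * x⁻¹)) = f x * F' := by field_simp
  rw [h8] at h7
  have hfx : 0 < f x := hpos t ht
  exact ⟨nonneg_of_mul_nonneg_right h7.1 hfx, by nlinarith [h7.2]⟩

/-- A function of class `𝒜` that is positive at one positive point is positive at all of them. -/
theorem ClassA.pos_of_pos (h : ClassA x₀ f) {a b : ℝ} (ha : Real.exp a ∈ dom x₀)
    (hb : Real.exp b ∈ dom x₀) (hfa : 0 < f (Real.exp a)) : 0 < f (Real.exp b) := by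
  by_contra hfb
  have hfb0 : f (Real.exp b) = 0 := le_antisymm (not_lt.1 hfb) (h.nonneg _ hb)
  have hdom : ∀ t, t ≤ max a b → Real.exp t ∈ dom x₀ := by
    intro t ht
    rcases le_total a b with hab | hab
    · rw [max_eq_right hab] at ht
      exact mem_dom_of_le (Real.exp_pos _).le (Real.exp_le_exp.2 ht) hb
    · rw [max_eq_left hab] at ht
      exact mem_dom_of_le (Real.exp_pos _).le (Real.exp_le_exp.2 ht) ha
  have hcont : ContinuousOn (fun t => f (Real.exp t)) (Icc (min a b) (max a b)) := fun t ht =>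
    (h.continuousAt_comp_exp (hdom t ht.2)).continuousWithinAt
  set Z := Icc (min a b) (max a b) ∩ (fun t => f (Real.exp t)) ⁻¹' {0}
  have hZ : IsCompact Z := isCompact_Icc.of_isClosed_subset
    (hcont.preimage_isClosed_of_isClosed isClosed_Icc isClosed_singleton) inter_subset_left
  have hZne : Z.Nonempty := ⟨b, ⟨min_le_right _ _, le_max_right _ _⟩, hfb0⟩
  have hposZ : ∀ t, t ∈ Icc (min a b) (max a b) → t ∉ Z → 0 < f (Real.exp t) := fun t ht htZ =>
    lt_of_le_of_ne (h.nonneg _ (hdom t ht.2)) fun h0 => htZ ⟨ht, h0.symm⟩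
  rcases lt_trichotomy a b with hab | rfl | hab
  · have hmin : min a b = a := min_eq_left hab.le
    have hmax : max a b = b := max_eq_right hab.le
    -- Here c is the first zero to the right of a. As f increases on the way to c, its limit there
    -- is positive, a contradiction.
    obtain ⟨hcI, hc0⟩ := hZ.sInf_mem hZne
    set c := sInf Z
    rw [hmin, hmax] at hcI hposZ
    have hac : a < c := lt_of_le_of_ne hcI.1 fun hac => by
      rw [← hac] at hc0; exact hfa.ne' hc0
    have hpos : ∀ t ∈ Ioo a c, 0 < f (Real.exp t) := fun t ht =>
      hposZ t ⟨ht.1.le, ht.2.le.trans hcI.2⟩ fun htZ =>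
        absurd (csInf_le hZ.bddBelow htZ) (not_le.2 ht.2)
    obtain ⟨-, hinc⟩ := h.log_comp_exp
      (fun t ht => hdom t (ht.2.le.trans (hcI.2.trans (le_max_right _ _)))) hpos
    obtain ⟨u, hu⟩ := exists_between hac
    have hlim : Tendsto (fun t => f (Real.exp t)) (𝓝[<] c) (𝓝 (f (Real.exp c))) :=
      (h.continuousAt_comp_exp (hdom c (hcI.2.trans (le_max_right _ _)))).tendsto.mono_left
        nhdsWithin_le_nhds
    have hge : f (Real.exp u) ≤ f (Real.exp c) := by
      refine ge_of_tendsto hlim ?_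
      filter_upwards [Ioo_mem_nhdsLT hu.2] with v hv
      have hv' : v ∈ Ioo a c := ⟨hu.1.trans hv.1, hv.2⟩
      exact (Real.log_le_log_iff (hpos u hu) (hpos v hv')).1 (hinc u hu v hv' hv.1.le).1
    have hc0' : f (Real.exp c) = 0 := hc0
    linarith [hpos u hu]
  · exact hfb hfa
  · have hmin : min a b = b := min_eq_right hab.le
    have hmax : max a b = a := max_eq_left hab.le
    -- Here c is the last zero to the left of a. Slope at most 1 gives f(e^u) ≥ f(e^v)e^{u−v}, which
    -- stays positive as u decreases to c.
    obtain ⟨hcI, hc0⟩ := hZ.sSup_mem hZne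
    set c := sSup Z
    rw [hmin, hmax] at hcI hposZ
    have hca : c < a := lt_of_le_of_ne hcI.2 fun hca => by
      rw [hca] at hc0; exact hfa.ne' hc0
    have hpos : ∀ t ∈ Ioo c a, 0 < f (Real.exp t) := fun t ht =>
      hposZ t ⟨hcI.1.trans ht.1.le, ht.2.le⟩ fun htZ =>
        absurd (le_csSup hZ.bddAbove htZ) (not_le.2 ht.1)
    obtain ⟨-, hinc⟩ := h.log_comp_exp
      (fun t ht => hdom t (ht.2.le.trans (le_max_left _ _))) hpos
    obtain ⟨v, hv⟩ := exists_between hca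
    have hlim : Tendsto (fun t => f (Real.exp t)) (𝓝[>] c) (𝓝 (f (Real.exp c))) :=
      (h.continuousAt_comp_exp (hdom c (hcI.2.trans (le_max_left _ _)))).tendsto.mono_left
        nhdsWithin_le_nhds
    have hge : f (Real.exp v) * Real.exp (c - v) ≤ f (Real.exp c) := by
      refine ge_of_tendsto hlim ?_
      filter_upwards [Ioo_mem_nhdsGT hv.1] with u hu
      have hu' : u ∈ Ioo c a := ⟨hu.1, hu.2.trans hv.2⟩
      have h1 := (hinc u hu' v hv hu.2.le).2
      rw [← Real.exp_log (hpos v hv), ← Real.exp_log (hpos u hu'), ← Real.exp_add,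
        Real.exp_le_exp]
      linarith [hu.1]
    have hc0' : f (Real.exp c) = 0 := hc0
    have := mul_pos (hpos v hv) (Real.exp_pos (c - v))
    linarith

end ClassA

/-! ### Class 𝒜 implies the inequality -/

section Sufficiency

variable {x₀ : EReal} {f : ℝ → ℝ} {n : ℕ} {A B : Matrix (Fin n) (Fin n) ℂ}

/-- If r in the domain bounds both spectra, then A, B ≤ r·1 and monotonicity gives λ_j(AB) ≤ r². -/
theorem sqrt_eig_mul_mem_dom (hx₀ : 0 < x₀) (hA : A.PosDef) (hB : B.PosDef)
    (hAs : spectrum ℝ A ⊆ dom x₀) (hBs : spectrum ℝ B ⊆ dom x₀) (j : Fin n) :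
    √(eig (A * B) j) ∈ dom x₀ := by
  obtain ⟨r₀, hr₀, hr₀0⟩ := exists_gt_mem_dom (x₀ := x₀) (x := 0) ⟨le_rfl, by exact_mod_cast hx₀⟩
  obtain ⟨r, hr, hmax⟩ := exists_max_image (insert r₀ (spectrum ℝ A ∪ spectrum ℝ B)) id
    ((A.finite_real_spectrum.union B.finite_real_spectrum).insert r₀) (insert_nonempty _ _)
  have hrdom : r ∈ dom x₀ := by
    rcases hr with rfl | hr | hr
    exacts [hr₀, hAs hr, hBs hr]
  have hr0 : 0 < r := hr₀0.trans_le (hmax r₀ (mem_insert _ _))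
  have h := eig_cfcExp_mono hA.1 hB.1 (G := fun x => Real.log x + 0) (H := fun _ => Real.log r)
    (fun x hx => by
      rw [add_zero]
      exact Real.log_le_log (spectrum_pos hA hx) (hmax x (Or.inr (Or.inl hx))))
    (fun x hx => by
      rw [add_zero]
      exact Real.log_le_log (spectrum_pos hB hx) (hmax x (Or.inr (Or.inr hx)))) j
  rw [cfcExp_log_add_const hA, cfcExp_log_add_const hB, eig_cfcExp_const hA.1 hB.1, two_mul,
    Real.exp_add, Real.exp_log hr0] at h
  refine mem_dom_of_le (Real.sqrt_nonneg _) (Real.sqrt_le_iff.2 ⟨hr0.le, ?_⟩) hrdom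
  simpa [sq] using h

theorem ClassA.logSubmajorizedBy (hx₀ : 0 < x₀) (h : ClassA x₀ f) (hA : A.PosDef) (hB : B.PosDef)
    (hAs : spectrum ℝ A ⊆ dom x₀) (hBs : spectrum ℝ B ⊆ dom x₀) :
    LogSubmajorizedBy (eig (cfc f A * cfc f B)) (fun j => f (√(eig (A * B) j)) ^ 2) := by
  intro k
  by_cases hf : ∃ a, Real.exp a ∈ dom x₀ ∧ 0 < f (Real.exp a)
  · obtain ⟨a, ha, hfa⟩ := hf
    have hpos : ∀ t, Real.exp t ∈ dom x₀ → 0 < f (Real.exp t) := fun t ht => h.pos_of_pos ha ht hfa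
    set D : Set ℝ := {t | Real.exp t ∈ dom x₀}
    set F : ℝ → ℝ := fun t => Real.log (f (Real.exp t))
    -- `ClassA.log_comp_exp` works on bounded open intervals. Since the domain is open on the right,
    -- there is always one reaching past z.
    have hF : ∀ z ∈ D, ∀ p, ∃ q, z < q ∧ ConcaveOn ℝ (Ioo p q) F ∧
        ∀ u ∈ Ioo p q, ∀ v ∈ Ioo p q, u ≤ v → F u ≤ F v ∧ F v - F u ≤ v - u := by
      intro z hz p
      obtain ⟨y, hy, hzy⟩ := exists_gt_mem_dom hz
      have hy0 : 0 < y := (Real.exp_pos z).trans hzy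
      have hdom : ∀ t ∈ Ioo p (Real.log y), Real.exp t ∈ dom x₀ := fun t ht =>
        mem_dom_of_le (Real.exp_pos t).le ((Real.lt_log_iff_exp_lt hy0).1 ht.2).le hy
      exact ⟨Real.log y, (Real.lt_log_iff_exp_lt hy0).2 hzy,
        h.log_comp_exp hdom fun t ht => hpos t (hdom t ht)⟩
    have hincr : ∀ x ∈ D, ∀ y ∈ D, x ≤ y → F x ≤ F y ∧ F y - F x ≤ y - x := by
      intro x _ y hy hxy
      obtain ⟨q, hq, -, hb⟩ := hF y hy (x - 1)
      exact hb x ⟨by linarith, by linarith⟩ y ⟨by linarith, by linarith⟩ hxy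
    -- The points that matter: logarithms of both spectra and of all √λ_j(AB). On them f is e^G
    -- exactly.
    let S : Finset ℝ := ((A.finite_real_spectrum.union B.finite_real_spectrum).union
      (finite_range fun j => √(eig (A * B) j))).toFinset.image Real.log
    have hpts : ∀ x ∈ (spectrum ℝ A ∪ spectrum ℝ B) ∪ range fun j => √(eig (A * B) j),
        x ∈ dom x₀ ∧ 0 < x ∧ Real.log x ∈ S := by
      intro x hx
      have hxS : Real.log x ∈ S := Finset.mem_image_of_mem _ ((Set.Finite.mem_toFinset _).2 hx)
      rcases hx with (hx | hx) | ⟨j, rfl⟩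
      · exact ⟨hAs hx, spectrum_pos hA hx, hxS⟩
      · exact ⟨hBs hx, spectrum_pos hB hx, hxS⟩
      · exact ⟨sqrt_eig_mul_mem_dom hx₀ hA hB hAs hBs j, Real.sqrt_pos.2 (eig_mul_pos hA hB j), hxS⟩
    obtain ⟨c, w, hw0, hw1, hw, -⟩ := exists_eq_sum_min (D := D) (F := F)
      (by
        intro x hx y hy z hz hxy hyz
        obtain ⟨q, hq, hconc, -⟩ := hF z hz (x - 1)
        have := hconc.slope_anti_adjacent (x := x) (y := y) (z := z)
          ⟨by linarith, by linarith⟩ ⟨by linarith, hq⟩ hxy hyz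
        rwa [div_le_div_iff₀ (sub_pos.2 hyz) (sub_pos.2 hxy)] at this)
      (fun x hx y hy hxy => (hincr x hx y hy hxy).1)
      (fun x hx y hy hxy => (hincr x hx y hy hxy).2) S
      (by
        intro s hs
        obtain ⟨x, hx, rfl⟩ := Finset.mem_image.1 hs
        obtain ⟨h1, h2, -⟩ := hpts x ((Set.Finite.mem_toFinset _).1 hx)
        change Real.exp (Real.log x) ∈ dom x₀
        rwa [Real.exp_log h2])
    have hgood := sum_min_log_mem_goodExponents k hA hB c hw0 hw1
    set G : ℝ → ℝ := fun x => c + ∑ s ∈ S, w s * min (Real.log x) s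
    have hfG : ∀ x ∈ (spectrum ℝ A ∪ spectrum ℝ B) ∪ range fun j => √(eig (A * B) j),
        f x = Real.exp (G x) := by
      intro x hx
      obtain ⟨h1, h2, h3⟩ := hpts x hx
      have h4 := hw _ h3
      simp only [F, Real.exp_log h2] at h4
      have h5 : 0 < f x := by
        have := hpos (Real.log x)
        rw [Real.exp_log h2] at this
        exact this h1
      rw [← Real.exp_log h5, h4]
    have hcA : cfc f A = cfcExp G A := cfc_congr fun x hx => hfG x (Or.inl (Or.inl hx))
    have hcB : cfc f B = cfcExp G B := cfc_congr fun x hx => hfG x (Or.inl (Or.inr hx))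
    rw [hcA, hcB]
    refine (show _ ≤ _ from hgood).trans_eq (Finset.prod_congr rfl fun j _ => ?_)
    have hj : f (√(eig (A * B) j)) = Real.exp (G (√(eig (A * B) j))) := hfG _ (Or.inr ⟨j, rfl⟩)
    change _ = f (√(eig (A * B) j)) ^ 2
    rw [hj, ← Real.exp_nat_mul]
    simp
  · have hzero : ∀ x ∈ spectrum ℝ A, f x = 0 := by
      intro x hx
      have hx0 := spectrum_pos hA hx
      by_contra hne
      refine hf ⟨Real.log x, ?_, ?_⟩ <;> rw [Real.exp_log hx0]
      · exact hAs hx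
      · exact lt_of_le_of_ne (h.nonneg x (hAs hx)) (Ne.symm hne)
    have hcA : cfc f A = 0 := by
      rw [cfc_congr (g := fun _ => (0 : ℝ)) hzero]
      exact cfc_const_zero ℝ A
    have h0 : ∀ j, eig (0 : Matrix (Fin n) (Fin n) ℂ) j = 0 := fun j => by
      simpa using eig_smul_one (n := n) 0 j
    rw [hcA, zero_mul, Finset.prod_eq_zero (Finset.mem_Iic.2 le_rfl) (h0 k)]
    exact Finset.prod_nonneg fun j _ => sq_nonneg _

end Sufficiency

/-! ### Two-by-two test matrices -/

section TwoByTwo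

theorem eig_fin_two_zero {M : Matrix (Fin 2) (Fin 2) ℂ} {τ δ : ℝ} (ht : M.trace = (τ : ℂ))
    (hd : M.det = (δ : ℂ)) (h : 4 * δ ≤ τ ^ 2) : eig M 0 = (τ + √(τ ^ 2 - 4 * δ)) / 2 := by
  set r := √(τ ^ 2 - 4 * δ)
  have hr : r ^ 2 = τ ^ 2 - 4 * δ := Real.sq_sqrt (by linarith)
  have hr0 : 0 ≤ r := Real.sqrt_nonneg _
  have hc : ((r : ℂ)) ^ 2 = (τ : ℂ) ^ 2 - 4 * (δ : ℂ) := by exact_mod_cast hr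
  rw [eig_eq_of_charpoly (d := ![(τ + r) / 2, (τ - r) / 2])]
  · rfl
  · intro i j hij
    fin_cases i <;> fin_cases j <;> simp at hij ⊢
    linarith
  · rw [charpoly_fin_two, ht, hd, Fin.prod_univ_two]
    have h1 : (δ : ℂ) = ((τ + r) / 2 : ℂ) * ((τ - r) / 2) := by linear_combination (1 / 4 : ℂ) * hc
    have h2 : (τ : ℂ) = ((τ + r) / 2 : ℂ) + (τ - r) / 2 := by ring
    simp only [Matrix.cons_val_zero, Matrix.cons_val_one]
    push_cast
    rw [h1]
    conv_lhs => rw [h2]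
    simp only [map_add, map_mul]
    ring_nf

/-- The real symmetric matrix with eigenvalue `a` at `(c, s)` and `b` on the orthogonal
complement, where `c ^ 2 + s ^ 2 = 1`. -/
def planar (a b c s : ℝ) : Matrix (Fin 2) (Fin 2) ℂ :=
  !![((b + (a - b) * c ^ 2 : ℝ) : ℂ), (((a - b) * (c * s) : ℝ) : ℂ);
    (((a - b) * (c * s) : ℝ) : ℂ), ((b + (a - b) * s ^ 2 : ℝ) : ℂ)]

theorem planar_posDef {a b : ℝ} (c s : ℝ) (hb : 0 < b) (hab : b ≤ a) : (planar a b c s).PosDef := by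
  have h : planar a b c s = (b : ℂ) • (1 : Matrix (Fin 2) (Fin 2) ℂ) +
      ((a - b : ℝ) : ℂ) • (!![(c : ℂ), (s : ℂ)]ᴴ * !![(c : ℂ), (s : ℂ)]) := by
    ext i j
    fin_cases i <;> fin_cases j <;> simp [planar, mul_apply] <;> ring_nf <;> simp
  rw [h]
  refine (PosDef.one.smul (by exact_mod_cast hb)).add_posSemidef ?_
  exact (posSemidef_conjTranspose_mul_self _).smul (by exact_mod_cast sub_nonneg.2 hab)

theorem planar_sub_mul_planar_sub {a b c s : ℝ} (hcs : c ^ 2 + s ^ 2 = 1) :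
    (planar a b c s - (a : ℂ) • 1) * (planar a b c s - (b : ℂ) • 1) = 0 := by
  have h : (c : ℂ) ^ 2 + (s : ℂ) ^ 2 = 1 := by exact_mod_cast hcs
  have hs : (s : ℂ) ^ 2 = 1 - (c : ℂ) ^ 2 := by linear_combination h
  ext i j
  fin_cases i <;> fin_cases j <;> simp [planar, mul_apply, Fin.sum_univ_two] <;> ring_nf <;>
    simp only [hs, show (s : ℂ) ^ 3 = s * s ^ 2 by ring, show (s : ℂ) ^ 4 = (s ^ 2) ^ 2 by ring] <;>
    ring

theorem spectrum_planar_subset {a b c s : ℝ} (hcs : c ^ 2 + s ^ 2 = 1) :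
    spectrum ℝ (planar a b c s) ⊆ {a, b} := by
  intro x hx
  have h1 : aeval (planar a b c s) ((X - C a) * (X - C b) : ℝ[X]) = 0 := by
    have h2 : ∀ r : ℝ, algebraMap ℝ (Matrix (Fin 2) (Fin 2) ℂ) r = (r : ℂ) • 1 := fun r => by
      rw [Algebra.algebraMap_eq_smul_one]; ext i j; simp
    simp only [map_mul, map_sub, aeval_X, aeval_C, h2]
    exact planar_sub_mul_planar_sub hcs
  have h2 := spectrum.subset_polynomial_aeval (planar a b c s) ((X - C a) * (X - C b) : ℝ[X])
    ⟨x, hx, rfl⟩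
  rw [h1, spectrum.zero_eq] at h2
  have h3 : (x - a) * (x - b) = 0 := by simpa using h2
  rcases mul_eq_zero.1 h3 with h | h
  · exact Or.inl (sub_eq_zero.1 h)
  · exact Or.inr (sub_eq_zero.1 h)

/-- On the spectrum, contained in {a, b}, f agrees with an affine function, and an affine function
of the matrix only changes its two eigenvalues. -/
theorem cfc_planar (f : ℝ → ℝ) {a b c s : ℝ} (hb : 0 < b) (hab : b < a) (hcs : c ^ 2 + s ^ 2 = 1) :
    cfc f (planar a b c s) = planar (f a) (f b) c s := by
  have hd : a - b ≠ 0 := (sub_pos.2 hab).ne'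
  set m := (f a - f b) / (a - b)
  have hm : m * (a - b) = f a - f b := div_mul_cancel₀ _ hd
  have hsa : IsSelfAdjoint (planar a b c s) := (planar_posDef c s hb hab.le).1.isSelfAdjoint
  have h1 : cfc f (planar a b c s) = cfc (fun x => (f b - m * b) + m * x) (planar a b c s) := by
    refine cfc_congr fun x hx => ?_
    rcases spectrum_planar_subset hcs hx with rfl | hx
    · linear_combination -hm
    · rw [mem_singleton_iff] at hx; subst hx; simp
  rw [h1, cfc_const_add (f b - m * b) (fun x => m * x) _ (by fun_prop) hsa,
    cfc_const_mul_id m _ hsa, Algebra.algebraMap_eq_smul_one]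
  have hm' : (m : ℂ) * (a - b) = f a - f b := by exact_mod_cast hm
  have hcs' : (c : ℂ) ^ 2 + (s : ℂ) ^ 2 = 1 := by exact_mod_cast hcs
  ext i j
  fin_cases i <;> fin_cases j <;> simp [planar]
  · linear_combination (c : ℂ) ^ 2 * hm'
  · linear_combination (c : ℂ) * s * hm'
  · linear_combination (c : ℂ) * s * hm'
  · linear_combination (s : ℂ) ^ 2 * hm'

theorem four_mul_le_planar {a b c s : ℝ} (hcs : c ^ 2 + s ^ 2 = 1) (ha : 0 ≤ a) (hb : 0 ≤ b) :
    4 * (a ^ 2 * b ^ 2) ≤ (c ^ 2 * (a ^ 2 + b ^ 2) + 2 * s ^ 2 * (a * b)) ^ 2 := by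
  have hs : s ^ 2 = 1 - c ^ 2 := by linarith
  have h1 : 2 * (a * b) ≤ c ^ 2 * (a ^ 2 + b ^ 2) + 2 * s ^ 2 * (a * b) := by
    rw [hs]; nlinarith [mul_nonneg (sq_nonneg c) (sq_nonneg (a - b))]
  nlinarith [mul_nonneg ha hb]

theorem eig_planar_mul_planar {a b c s : ℝ} (hcs : c ^ 2 + s ^ 2 = 1) (ha : 0 ≤ a) (hb : 0 ≤ b) :
    eig (planar a b 1 0 * planar a b c s) 0 =
      ((c ^ 2 * (a ^ 2 + b ^ 2) + 2 * s ^ 2 * (a * b)) +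
        √((c ^ 2 * (a ^ 2 + b ^ 2) + 2 * s ^ 2 * (a * b)) ^ 2 - 4 * (a ^ 2 * b ^ 2))) / 2 := by
  have hs : (s : ℂ) ^ 2 = 1 - (c : ℂ) ^ 2 := by
    have : (c : ℂ) ^ 2 + (s : ℂ) ^ 2 = 1 := by exact_mod_cast hcs
    linear_combination this
  refine eig_fin_two_zero ?_ ?_ (four_mul_le_planar hcs ha hb)
  · simp [planar, trace_fin_two]
    rw [hs]; ring
  · rw [det_mul, det_fin_two, det_fin_two]
    simp [planar]
    linear_combination ((a : ℂ) * b * (a - b) * b) * hs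

/-- The right side is the larger root of t² − τt + a²b². At y = a²c² either this polynomial is
nonpositive, so y lies between the roots, or y is at most the vertex τ/2. -/
theorem sq_mul_sq_le_top_root {a b c s : ℝ} (hcs : c ^ 2 + s ^ 2 = 1) (ha : 0 ≤ a) (hb : 0 ≤ b) :
    a ^ 2 * c ^ 2 ≤ ((c ^ 2 * (a ^ 2 + b ^ 2) + 2 * s ^ 2 * (a * b)) +
        √((c ^ 2 * (a ^ 2 + b ^ 2) + 2 * s ^ 2 * (a * b)) ^ 2 - 4 * (a ^ 2 * b ^ 2))) / 2 := by
  obtain ⟨K, hK⟩ : ∃ K, c ^ 2 = K := ⟨_, rfl⟩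
  have hs : s ^ 2 = 1 - K := by linarith
  have hK0 : 0 ≤ K := hK ▸ sq_nonneg c
  have hK1 : 0 ≤ 1 - K := hs ▸ sq_nonneg s
  rw [hK, hs]
  set τ := K * (a ^ 2 + b ^ 2) + 2 * (1 - K) * (a * b) with hτ
  set y := a ^ 2 * K
  rcases le_total (b * (1 + K)) (2 * K * a) with h | h
  · have hp : y ^ 2 - τ * y + a ^ 2 * b ^ 2 ≤ 0 := by
      have : y ^ 2 - τ * y + a ^ 2 * b ^ 2 =
          a ^ 2 * b * (1 - K) * (b * (1 + K) - 2 * K * a) := by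
        simp only [hτ, y]; ring
      rw [this]
      exact mul_nonpos_of_nonneg_of_nonpos (by positivity) (by linarith)
    have h2 : 2 * y - τ ≤ √(τ ^ 2 - 4 * (a ^ 2 * b ^ 2)) :=
      Real.le_sqrt_of_sq_le (by nlinarith)
    linarith
  · have h1 : 0 ≤ (1 + K) ^ 2 * (τ - 2 * y) := by
      have e : (1 + K) ^ 2 * (τ - 2 * y) = K * ((b * (1 + K)) ^ 2 - (2 * K * a) ^ 2) +
          2 * (1 - K) * (1 + K) * a * (b * (1 + K) - 2 * K * a) +
          K * a ^ 2 * ((1 - K) * (3 + K)) := by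
        simp only [hτ, y]; ring
      rw [e]
      have h3 : (2 * K * a) ^ 2 ≤ (b * (1 + K)) ^ 2 := pow_le_pow_left₀ (by positivity) h 2
      have h4 := mul_nonneg hK0 (sub_nonneg.2 h3)
      have h5 : 0 ≤ 2 * (1 - K) * (1 + K) * a * (b * (1 + K) - 2 * K * a) :=
        mul_nonneg (by positivity) (sub_nonneg.2 h)
      have h6 : 0 ≤ K * a ^ 2 * ((1 - K) * (3 + K)) := by positivity
      linarith
    have h2 : 0 ≤ τ - 2 * y := nonneg_of_mul_nonneg_right h1 (by positivity)
    linarith [Real.sqrt_nonneg (τ ^ 2 - 4 * (a ^ 2 * b ^ 2))]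

end TwoByTwo

/-! ### The inequality implies class 𝒜 -/

section Necessity

variable {x₀ : EReal} {f : ℝ → ℝ}

theorem prod_Iic_zero {n : ℕ} (x : Fin (n + 1) → ℝ) : ∏ j ∈ Finset.Iic 0, x j = x 0 := by
  have : Finset.Iic (0 : Fin (n + 1)) = {0} := by ext i; simp
  rw [this, Finset.prod_singleton]

theorem mul_le_sq_of_logSubmajorizedBy
    (h : ∀ (A B : Matrix (Fin 1) (Fin 1) ℂ), A.PosDef → B.PosDef →
        spectrum ℝ A ⊆ dom x₀ → spectrum ℝ B ⊆ dom x₀ →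
        LogSubmajorizedBy (eig (cfc f A * cfc f B)) (fun j => f (√(eig (A * B) j)) ^ 2))
    {a b : ℝ} (ha : a ∈ dom x₀) (hb : b ∈ dom x₀) (ha0 : 0 < a) (hb0 : 0 < b) :
    f a * f b ≤ f (√(a * b)) ^ 2 := by
  have e : ∀ r : ℝ, algebraMap ℝ (Matrix (Fin 1) (Fin 1) ℂ) r = (r : ℂ) • 1 := fun r => by
    rw [Algebra.algebraMap_eq_smul_one]; ext i j; simp
  have hp : ∀ r : ℝ, 0 < r → (algebraMap ℝ (Matrix (Fin 1) (Fin 1) ℂ) r).PosDef := fun r hr => by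
    rw [e]; exact PosDef.one.smul (by exact_mod_cast hr)
  have hs : ∀ r ∈ dom x₀, spectrum ℝ (algebraMap ℝ (Matrix (Fin 1) (Fin 1) ℂ) r) ⊆ dom x₀ :=
    fun r hr => by rw [spectrum.scalar_eq]; simpa using hr
  have h1 := h _ _ (hp a ha0) (hp b hb0) (hs a ha) (hs b hb) 0
  simp only [prod_Iic_zero] at h1
  rwa [cfc_algebraMap, cfc_algebraMap, ← map_mul, ← map_mul, e, e, eig_smul_one,
    eig_smul_one] at h1

theorem top_root_le_of_logSubmajorizedBy (hf0 : ∀ x ∈ dom x₀, 0 ≤ f x)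
    (h : ∀ (A B : Matrix (Fin 2) (Fin 2) ℂ), A.PosDef → B.PosDef →
        spectrum ℝ A ⊆ dom x₀ → spectrum ℝ B ⊆ dom x₀ →
        LogSubmajorizedBy (eig (cfc f A * cfc f B)) (fun j => f (√(eig (A * B) j)) ^ 2))
    {a b c s : ℝ} (ha : a ∈ dom x₀) (hb : 0 < b) (hab : b < a) (hcs : c ^ 2 + s ^ 2 = 1) :
    ((c ^ 2 * (f a ^ 2 + f b ^ 2) + 2 * s ^ 2 * (f a * f b)) +
      √((c ^ 2 * (f a ^ 2 + f b ^ 2) + 2 * s ^ 2 * (f a * f b)) ^ 2 -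
        4 * (f a ^ 2 * f b ^ 2))) / 2 ≤
    f (√(((c ^ 2 * (a ^ 2 + b ^ 2) + 2 * s ^ 2 * (a * b)) +
        √((c ^ 2 * (a ^ 2 + b ^ 2) + 2 * s ^ 2 * (a * b)) ^ 2 - 4 * (a ^ 2 * b ^ 2))) / 2)) ^ 2 := by
  have hbd : b ∈ dom x₀ := mem_dom_of_le hb.le hab.le ha
  have hs : ∀ c s : ℝ, c ^ 2 + s ^ 2 = 1 → spectrum ℝ (planar a b c s) ⊆ dom x₀ := by
    intro c s hcs x hx
    rcases spectrum_planar_subset hcs hx with rfl | hx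
    · exact ha
    · rw [mem_singleton_iff] at hx; rwa [hx]
  have h1 := h _ _ (planar_posDef 1 0 hb hab.le) (planar_posDef c s hb hab.le)
    (hs 1 0 (by norm_num)) (hs c s hcs) 0
  simp only [prod_Iic_zero] at h1
  rwa [cfc_planar f hb hab (by norm_num), cfc_planar f hb hab hcs,
    eig_planar_mul_planar hcs (hf0 a ha) (hf0 b hbd),
    eig_planar_mul_planar hcs (hb.le.trans hab.le) hb.le] at h1

/-- Positive definite matrices see positive arguments only; the argument 0 is reached by continuity
as a → 0+. -/
theorem geometricallyConcave_of_mul_le_sq (hf : ContinuousOn f (dom x₀))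
    (hf0 : ∀ x ∈ dom x₀, 0 ≤ f x)
    (h : ∀ a ∈ dom x₀, ∀ b ∈ dom x₀, 0 < a → 0 < b → f a * f b ≤ f (√(a * b)) ^ 2) :
    GeometricallyConcave x₀ f := by
  have h1 : ∀ b ∈ dom x₀, 0 < b → f 0 * f b ≤ f (√(0 * b)) ^ 2 := by
    intro b hb hb0
    have h0 : (0 : ℝ) ∈ dom x₀ := mem_dom_of_le le_rfl hb0.le hb
    have hev : ∀ᶠ a in 𝓝[>] (0 : ℝ), a ∈ dom x₀ ∧ 0 < a := by
      filter_upwards [Ioo_mem_nhdsGT hb0] with a ha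
      exact ⟨mem_dom_of_le ha.1.le ha.2.le hb, ha.1⟩
    have ht : Tendsto (fun a : ℝ => a) (𝓝[>] 0) (𝓝[dom x₀] 0) :=
      tendsto_nhdsWithin_iff.2 ⟨nhdsWithin_le_nhds, hev.mono fun a ha => ha.1⟩
    have ht' : Tendsto (fun a : ℝ => √(a * b)) (𝓝[>] 0) (𝓝[dom x₀] (√(0 * b))) := by
      refine tendsto_nhdsWithin_iff.2 ⟨?_, hev.mono fun a ha => sqrt_mul_mem_dom ha.1 hb⟩
      have : Continuous fun a : ℝ => √(a * b) := by fun_prop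
      exact (this.tendsto 0).mono_left nhdsWithin_le_nhds
    have hl := ((hf 0 h0).tendsto.comp ht).mul_const (f b)
    have hr := ((hf _ (sqrt_mul_mem_dom h0 hb)).tendsto.comp ht').pow 2
    exact le_of_tendsto_of_tendsto hl hr (hev.mono fun a ha => h a ha.1 b hb ha.2 hb0)
  intro x hx y hy
  have hm := hf0 _ (sqrt_mul_mem_dom hx hy)
  refine Real.sqrt_le_iff.2 ⟨hm, ?_⟩
  rcases hx.1.eq_or_lt with rfl | hx0
  · rcases hy.1.eq_or_lt with rfl | hy0
    · simp [sq]
    · exact h1 y hy hy0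
  · rcases hy.1.eq_or_lt with rfl | hy0
    · rw [mul_comm (f x), mul_comm x]; exact h1 x hx hx0
    · exact h x hx y hy hx0 hy0

/-- For A = B = diag(a, b) the top eigenvalue of f(A)² is max(f(a)², f(b)²), and it is bounded by
f(a)². -/
theorem monotone_of_logSubmajorizedBy (hf0 : ∀ x ∈ dom x₀, 0 ≤ f x)
    (h : ∀ (A B : Matrix (Fin 2) (Fin 2) ℂ), A.PosDef → B.PosDef →
        spectrum ℝ A ⊆ dom x₀ → spectrum ℝ B ⊆ dom x₀ →
        LogSubmajorizedBy (eig (cfc f A * cfc f B)) (fun j => f (√(eig (A * B) j)) ^ 2))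
    {a b : ℝ} (ha : a ∈ dom x₀) (hb : 0 < b) (hab : b < a) : f b ≤ f a := by
  have h1 := top_root_le_of_logSubmajorizedBy hf0 h (c := 1) (s := 0) ha hb hab (by norm_num)
  have e : ∀ u v : ℝ, (1 ^ 2 * (u ^ 2 + v ^ 2) + 2 * 0 ^ 2 * (u * v)) ^ 2 - 4 * (u ^ 2 * v ^ 2) =
      (u ^ 2 - v ^ 2) ^ 2 := fun u v => by ring
  have ha0 : 0 ≤ a := hb.le.trans hab.le
  rw [e, e, Real.sqrt_sq (by nlinarith : 0 ≤ a ^ 2 - b ^ 2), Real.sqrt_sq_eq_abs] at h1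
  rw [show (1 ^ 2 * (a ^ 2 + b ^ 2) + 2 * 0 ^ 2 * (a * b) + (a ^ 2 - b ^ 2)) / 2 = a ^ 2 by ring,
    Real.sqrt_sq ha0] at h1
  have h2 := neg_abs_le (f a ^ 2 - f b ^ 2)
  exact le_of_abs_le (abs_le_of_sq_le_sq (by linarith) (hf0 a ha))

/-- Take diag(a, b) and its copy rotated by an angle of cosine c. As b → 0 the top eigenvalue of AB
tends to (ca)², while that of f(A)f(B) stays at least c²f(a)². -/
theorem mul_le_comp_mul_of_logSubmajorizedBy (hf : ContinuousOn f (dom x₀))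
    (hf0 : ∀ x ∈ dom x₀, 0 ≤ f x)
    (h : ∀ (A B : Matrix (Fin 2) (Fin 2) ℂ), A.PosDef → B.PosDef →
        spectrum ℝ A ⊆ dom x₀ → spectrum ℝ B ⊆ dom x₀ →
        LogSubmajorizedBy (eig (cfc f A * cfc f B)) (fun j => f (√(eig (A * B) j)) ^ 2))
    {a c : ℝ} (ha : a ∈ dom x₀) (ha0 : 0 < a) (hc0 : 0 < c) (hc1 : c ≤ 1) :
    c * f a ≤ f (c * a) := by
  set s := √(1 - c ^ 2)
  have hcs : c ^ 2 + s ^ 2 = 1 := by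
    rw [Real.sq_sqrt (by nlinarith)]; ring
  set g : ℝ → ℝ := fun b => √(((c ^ 2 * (a ^ 2 + b ^ 2) + 2 * s ^ 2 * (a * b)) +
        √((c ^ 2 * (a ^ 2 + b ^ 2) + 2 * s ^ 2 * (a * b)) ^ 2 - 4 * (a ^ 2 * b ^ 2))) / 2)
  have hg : Continuous g := by simp only [g]; fun_prop
  have hg0 : g 0 = c * a := by
    simp only [g]
    rw [show (c ^ 2 * (a ^ 2 + 0 ^ 2) + 2 * s ^ 2 * (a * 0)) ^ 2 - 4 * (a ^ 2 * 0 ^ 2) =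
      (c ^ 2 * a ^ 2) ^ 2 by ring, Real.sqrt_sq (by positivity),
      show (c ^ 2 * (a ^ 2 + 0 ^ 2) + 2 * s ^ 2 * (a * 0) + c ^ 2 * a ^ 2) / 2 = (c * a) ^ 2 by ring,
      Real.sqrt_sq (by positivity)]
  have hca0 : 0 < c * a := mul_pos hc0 ha0
  have hca : c * a ∈ dom x₀ := mem_dom_of_le hca0.le (by nlinarith) ha
  have hlim : Tendsto (fun b => f (g b) ^ 2) (𝓝[>] 0) (𝓝 (f (c * a) ^ 2)) := by
    have h1 : ContinuousAt f (g 0) := by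
      rw [hg0]; exact hf.continuousAt (dom_mem_nhds hca hca0)
    have h2 := (ContinuousAt.comp h1 hg.continuousAt).tendsto.pow 2
    simp only [Function.comp_apply, hg0] at h2
    exact h2.mono_left nhdsWithin_le_nhds
  have hle : f a ^ 2 * c ^ 2 ≤ f (c * a) ^ 2 := by
    refine ge_of_tendsto hlim ?_
    filter_upwards [Ioo_mem_nhdsGT ha0] with b hb
    exact (sq_mul_sq_le_top_root hcs (hf0 a ha)
      (hf0 b (mem_dom_of_le hb.1.le hb.2.le ha))).trans
      (top_root_le_of_logSubmajorizedBy hf0 h ha hb.1 hb.2 hcs)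
  refine le_of_abs_le (abs_le_of_sq_le_sq ?_ (hf0 _ hca))
  rw [mul_pow]; linarith

/-- Left difference quotients suffice: monotonicity makes them nonnegative, and the scaling bound
with c = y/x makes them at most f(x)/x. At x = 0 the claim is just f(0) ≥ 0. -/
theorem deriv_bounds_of_monotone_of_mul_le (hf0 : ∀ x ∈ dom x₀, 0 ≤ f x)
    (hmono : ∀ a ∈ dom x₀, ∀ b, 0 < b → b < a → f b ≤ f a)
    (hmul : ∀ a ∈ dom x₀, 0 < a → ∀ c, 0 < c → c ≤ 1 → c * f a ≤ f (c * a))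
    {x f' : ℝ} (hx : x ∈ dom x₀) (hd : HasDerivWithinAt f f' (dom x₀) x) :
    0 ≤ x * f' ∧ x * f' ≤ f x := by
  rcases hx.1.eq_or_lt with rfl | hx0
  · simpa using hf0 0 hx
  have hlim := (hasDerivAt_iff_tendsto_slope.1 (hd.hasDerivAt (dom_mem_nhds hx hx0))).mono_left
    (nhdsWithin_mono x (fun y (hy : y < x) => hy.ne) : 𝓝[<] x ≤ 𝓝[≠] x)
  have hlo : 0 ≤ f' := by
    refine ge_of_tendsto hlim ?_
    filter_upwards [Ioo_mem_nhdsLT hx0] with y hy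
    rw [slope_def_field]
    exact div_nonneg_of_nonpos (sub_nonpos.2 (hmono x hx y hy.1 hy.2)) (sub_nonpos.2 hy.2.le)
  have hup : f' ≤ f x / x := by
    refine le_of_tendsto hlim ?_
    filter_upwards [Ioo_mem_nhdsLT hx0] with y hy
    have h1 := hmul x hx hx0 (y / x) (div_pos hy.1 hx0) ((div_le_one hx0).2 hy.2.le)
    rw [div_mul_cancel₀ _ hx0.ne'] at h1
    rw [slope_def_field, div_le_iff_of_neg (sub_neg.2 hy.2)]
    have h2 : f x / x * (y - x) = y / x * f x - f x := by field_simp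
    linarith
  refine ⟨mul_nonneg hx0.le hlo, ?_⟩
  rw [le_div_iff₀ hx0] at hup
  linarith

end Necessity

end GeomALT

theorem mainTheorem1 (x₀ : EReal) (hx₀ : 0 < x₀) (f : ℝ → ℝ)
    (hf : ContinuousOn f (GeomALT.dom x₀)) (hf0 : ∀ x ∈ GeomALT.dom x₀, 0 ≤ f x) :
    (∀ (n : ℕ) (A B : Matrix (Fin n) (Fin n) ℂ), A.PosDef → B.PosDef →
        spectrum ℝ A ⊆ GeomALT.dom x₀ → spectrum ℝ B ⊆ GeomALT.dom x₀ →
        GeomALT.LogSubmajorizedBy (GeomALT.eig (cfc f A * cfc f B))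
          (fun j => f (√(GeomALT.eig (A * B) j)) ^ 2)) ↔
      GeomALT.ClassA x₀ f := by
  refine ⟨fun h => ?_, fun h n A B hA hB hAs hBs => h.logSubmajorizedBy hx₀ hA hB hAs hBs⟩
  refine ⟨hf, hf0, GeomALT.geometricallyConcave_of_mul_le_sq hf hf0 fun a ha b hb ha0 hb0 =>
    GeomALT.mul_le_sq_of_logSubmajorizedBy (h 1) ha hb ha0 hb0, fun x hx f' hd => ?_⟩
  exact GeomALT.deriv_bounds_of_monotone_of_mul_le hf0
    (fun a ha b hb hab => GeomALT.monotone_of_logSubmajorizedBy hf0 (h 2) ha hb hab)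
    (fun a ha ha0 c hc0 hc1 =>
      GeomALT.mul_le_comp_mul_of_logSubmajorizedBy hf hf0 (h 2) ha ha0 hc0 hc1) hx hd
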